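/- Let $n\ge 2$. **Graphs.** A MOY-type graph is a diagram built by concatenation $\circ$ (with $\Phi$ below $\Gamma$ in $\Gamma\circ\Phi$) and juxtaposition $\otimes$ from an oriented strand $\mathrm{id}_1$, a cap, a cup, the graph $S:\uparrow\uparrow\,\to\,\uparrow\uparrow$ (two strands merge into an edge labelled $2$, which splits again), a graph $T:\uparrow\uparrow\uparrow\,\to\,\uparrow\uparrow\uparrow$, and their duals (all arrows reversed). Put $\mathrm{id}_2=\mathrm{id}_1\otimes\mathrm{id}_1$. Consider formal finite direct sums of shifted graphs $\Gamma\{m\}$, $m\in\mathbb Z$, with fixed source and target, and put $[m]\Gamma=\Gamma\{1-m\}\oplus\Gamma\{3-m\}\oplus\cdots\oplus\Gamma\{m-1\}$. **Morphisms.** They are generated under $\mathbb Q$-linear combinations, composition, $\circ$, $\otimes$, shifts, direct sums (matrices) and horizontal and vertical reflections by: identities; the invertible arrows inserting an identity above or below a graph; invertible arrows realizing the planar isotopies that slide juxtaposed diagrams past each other or straighten a zigzag; arrows $\chi_0:\mathrm{id}_2\to S\{1\}$, $\chi_1:S\{-1\}\to\mathrm{id}_2$, $\epsilon:\mathrm{id}_1\{-1\}\to\mathrm{id}_1\{1\}$,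 $\alpha,\gamma:S\{-1\}\to S\{1\}$; and invertible arrows $\lambda:\bigcirc\to[n]\emptyset$, $\mu:\overline S\to[n-1]\,\mathrm{id}_1$ ($\overline{\Gamma}$ denotes the closure of one strand of $\Gamma$), $\varphi,\psi:S\circ S\to S\{-1\}\oplus S\{1\}$, $\nu:\widehat{S\otimes S^\vee}\to(\mathrm{cup}\circ\mathrm{cap})\oplus[n-2](\mathrm{id}_1\otimes\mathrm{id}_1^\vee)$ ($\widehat{\ \cdot\ }$ denotes the closure of the two inner strands), $\eta:(S\otimes1)\circ(1\otimes S)\circ(S\otimes 1)\to(S\otimes1)\oplus T$. Insertions of identities are omitted from the notation: e.g. $\chi_0\circ1:S\to S\circ S\{1\}$ is $S\cong\mathrm{id}_2\circ S\to S\circ S\{1\}$, $\;1\circ\chi_0:S\to S\circ S\{1\}$ is $S\cong S\circ\mathrm{id}_2\to S\circ S\{1\}$, and $\chi_0\circ 1:\mathrm{id}_2\to S\{1\}$ is $\mathrm{id}_2\cong\mathrm{id}_2\circ\mathrm{id}_2\to S\circ\mathrm{id}_2\{1\}\cong S\{1\}$. **Relations.** One always imposes the associativity, unit, bilinearity and interchange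 laws for composition, $\circ$ and $\otimes$, the naturality of the insertions of identities and of the sliding isotopies, the triangle identity for the insertions, the compatibility of reflections with all operations, the invertibility of the arrows called invertible above, and the relations $$\varphi\,(1\circ\chi_0)=\binom{1}{0},\qquad \varphi\,(\chi_0\circ1)=\binom{1}{\alpha},\qquad \psi\,(\chi_0\circ1)=\binom{1}{\gamma},$$ $$\psi\,(1\circ\alpha)=\begin{pmatrix}0&1\\0&0\end{pmatrix}\varphi,\qquad \varphi\,(1\circ\gamma)=\begin{pmatrix}0&1\\0&0\end{pmatrix}\psi .$$ In addition, let $E$ be an arbitrary subset (possibly empty, possibly everything) of the following relations, and impose also those in $E$: - $\chi_1\chi_0=0$; $\;\alpha=(1\circ\chi_1)(\chi_0\circ1)$; $\;1\circ\chi_1=(0\;1)\,\varphi$; $\;1\otimes\chi_0=0:\ S\otimes 1\to(S\otimes1)\circ(1\otimes S)\{1\}$; - $\lambda\epsilon=\begin{pmatrix}0&1\\0&0\end{pmatrix}\lambda$ with respect to $[n]\{-1\}=\mathbb Q\{-n\}\oplus[n-1]$ and $[n]\{1\}=[n-1]\oplus\mathbb Q\{n\}$; - $\mu\,\overline{\chi_0}=(0\;1)(\lambda\otimes1)$,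 $\;(\lambda\otimes1)\,\overline{\chi_1}=\binom10\mu$, $\;\mu\,\overline{\alpha}=0$, $\;\mu\,\overline{\gamma}=\epsilon\,\mu$; - $\nu\,(\chi_0\otimes1)=\begin{pmatrix}0&0\\0&1\end{pmatrix}(1\otimes\mu)$, $\;(\mu\otimes1)(1\otimes\chi_1)=\begin{pmatrix}0&1\\0&0\end{pmatrix}\nu$, $\;\eta\,(\chi_0\otimes1)=\binom{\chi_1}{0}$; - a left-right mirror image of one of $\chi_0,\chi_1,\epsilon,\alpha,\gamma,\varphi,\psi$ (which has the same source and target) equals that arrow. (The category of formal direct sums underlying $\mathbf{KR}$ is the case where $E$ contains all of these.) **Equivalence.** Equivalence of bounded formal complexes is the equivalence relation generated by isomorphism of complexes and by the removal of a term $N\xrightarrow{1}N$ that occurs as a subcomplex or as a quotient complex; that is, $$\cdots\to M_{i-1}\xrightarrow{\binom{\alpha_{i-1}}{A_{i-1}}}N\oplus M_i\xrightarrow{\left(\begin{smallmatrix}1&\alpha_i\\0&A_i\end{smallmatrix}\right)}N\oplus M_{i+1}\xrightarrow{(0\;A_{i+1})}M_{i+2}\to\cdots$$ and $$\cdots\to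 M_{i-1}\xrightarrow{\binom{A_{i-1}}{0}}M_i\oplus N\xrightarrow{\left(\begin{smallmatrix}A_i&\alpha_i\\0&1\end{smallmatrix}\right)}M_{i+1}\oplus N\xrightarrow{(A_{i+1}\;\alpha_{i+1})}M_{i+2}\to\cdots$$ are equivalent to $\cdots\to M_{i-1}\xrightarrow{A_{i-1}}M_i\xrightarrow{A_i}M_{i+1}\xrightarrow{A_{i+1}}M_{i+2}\to\cdots$. **Proposition.** For every such $E$ the following holds, where $\mathrm{id}_2$ in the top row is in degree $0$ and the vertical arrow in column $m$ enters the total differential with the sign $(-1)^m$. 1. For every $k\ge1$, the total complex of the two-row bicomplex $$\begin{array}{ccccccccccc} \mathrm{id}_2&\xrightarrow{\chi_0}&S\{1\}&\xrightarrow{\alpha}&S\{3\}&\xrightarrow{\gamma}&S\{5\}&\xrightarrow{\alpha}\cdots\xrightarrow{\alpha}&S\{4k-1\}\\ {\scriptstyle\chi_0\circ1}\downarrow&&{\scriptstyle\chi_0\circ1}\downarrow&&{\scriptstyle\chi_0\circ1}\downarrow&&{\scriptstyle\chi_0\circ1}\downarrow&&{\scriptstyle\chi_0\circ1}\downarrow\\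 S\{1\}&\xrightarrow{1\circ\chi_0}&S\circ S\{2\}&\xrightarrow{1\circ\alpha}&S\circ S\{4\}&\xrightarrow{1\circ\gamma}&S\circ S\{6\}&\xrightarrow{1\circ\alpha}\cdots\xrightarrow{1\circ\alpha}&S\circ S\{4k\} \end{array}$$ is equivalent to the complex $$\mathrm{id}_2\xrightarrow{\chi_0}S\{1\}\xrightarrow{\alpha}S\{3\}\xrightarrow{\gamma}S\{5\}\xrightarrow{\alpha}\cdots\xrightarrow{\alpha}S\{4k-1\}\xrightarrow{\gamma}S\{4k+1\}.$$ 2. For every $k\ge0$, the total complex of the analogous bicomplex whose top row is $$\mathrm{id}_2\xrightarrow{\chi_0}S\{1\}\xrightarrow{\alpha}S\{3\}\xrightarrow{\gamma}\cdots\xrightarrow{\gamma}S\{4k+1\}$$ and whose bottom row is $$S\{1\}\xrightarrow{1\circ\chi_0}S\circ S\{2\}\xrightarrow{1\circ\alpha}S\circ S\{4\}\xrightarrow{1\circ\gamma}\cdots\xrightarrow{1\circ\gamma}S\circ S\{4k+2\}$$ (for $k=0$: top row $\mathrm{id}_2\to S\{1\}$, bottom row $S\{1\}\to S\circ S\{2\}$),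 with vertical arrows $\chi_0\circ 1$, is equivalent to the complex $$\mathrm{id}_2\xrightarrow{\chi_0}S\{1\}\xrightarrow{\alpha}S\{3\}\xrightarrow{\gamma}S\{5\}\xrightarrow{\alpha}\cdots\xrightarrow{\gamma}S\{4k+1\}\xrightarrow{\alpha}S\{4k+3\}.$$ -/

import Mathlib

open CategoryTheory CategoryTheory.Limits

namespace MOY

/-! ## Diagrams -/

/-- Orientation of a strand carrying the label `1`. -/
inductive Dir
  | up
  | down

/-- Reversal of orientation. -/
def Dir.flip : Dir → Dir
  | up => down
  | down => up

/-- Source and target data of a diagram: a finite sequence of oriented boundary points. -/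
abbrev Word := List Dir

/-- Expressions for MOY-type graphs, built from elementary pieces by concatenation `comp Γ Φ`
(this is `Γ ∘ Φ`, with `Φ` below `Γ`) and juxtaposition `tensor Γ Φ`. The constructor `cap d` is
the evaluation `(d, d.flip) → ∅`, `cup d` is the coevaluation `∅ → (d, d.flip)`; `S d` (two
strands merging into an edge labelled `2` and splitting again) and `T d` (the same with three
strands) have all their boundary points oriented by `d`, so that `S down`, `T down` are the
duals of `S up`, `T up`. -/
inductive Graph
  | empty
  | strand (d : Dir)
  | cap (d : Dir)
  | cup (d : Dir)
  | S (d : Dir)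
  | T (d : Dir)
  | comp (Γ Φ : Graph)
  | tensor (Γ Φ : Graph)

namespace Graph

/-- The incoming (bottom) boundary. -/
def src : Graph → Word
  | empty => []
  | strand d => [d]
  | cap d => [d, d.flip]
  | cup _ => []
  | S d => [d, d]
  | T d => [d, d, d]
  | comp _ Φ => Φ.src
  | tensor Γ Φ => Γ.src ++ Φ.src

/-- The outgoing (top) boundary. -/
def tgt : Graph → Word
  | empty => []
  | strand d => [d]
  | cap _ => []
  | cup d => [d, d.flip]
  | S d => [d, d]
  | T d => [d, d, d]
  | comp Γ _ => Γ.tgt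
  | tensor Γ Φ => Γ.tgt ++ Φ.tgt

/-- Every concatenation in the expression is along matching boundaries. -/
def WF : Graph → Prop
  | comp Γ Φ => Γ.WF ∧ Φ.WF ∧ Γ.src = Φ.tgt
  | tensor Γ Φ => Γ.WF ∧ Φ.WF
  | _ => True

/-- The diagram of vertical strands on a word. -/
def idWord : Word → Graph
  | [] => empty
  | [d] => strand d
  | d :: e :: w => tensor (strand d) (idWord (e :: w))

/-- Left-right mirror image. -/
def lr : Graph → Graph
  | empty => empty
  | strand d => strand d
  | cap d => cap d.flip
  | cup d => cup d.flip
  | S d => S d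
  | T d => T d
  | comp Γ Φ => comp Γ.lr Φ.lr
  | tensor Γ Φ => tensor Φ.lr Γ.lr

/-- Up-down mirror image. -/
def ud : Graph → Graph
  | empty => empty
  | strand d => strand d.flip
  | cap d => cup d.flip
  | cup d => cap d.flip
  | S d => S d.flip
  | T d => T d.flip
  | comp Γ Φ => comp Φ.ud Γ.ud
  | tensor Γ Φ => tensor Γ.ud Φ.ud

/-- Two expressions that describe the same diagram: concatenation and juxtaposition are
associative and the empty diagram is neutral for juxtaposition. -/
inductive Same : Graph → Graph → Prop
  | refl (Γ) : Same Γ Γ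
  | symm {Γ Δ} : Same Γ Δ → Same Δ Γ
  | trans {Γ Δ Θ} : Same Γ Δ → Same Δ Θ → Same Γ Θ
  | comp {Γ Γ' Φ Φ'} : Same Γ Γ' → Same Φ Φ' → Same (comp Γ Φ) (comp Γ' Φ')
  | tensor {Γ Γ' Φ Φ'} : Same Γ Γ' → Same Φ Φ' → Same (tensor Γ Φ) (tensor Γ' Φ')
  | comp_assoc (Γ Φ Ψ) : Same (.comp (.comp Γ Φ) Ψ) (.comp Γ (.comp Φ Ψ))
  | tensor_assoc (Γ Φ Ψ) : Same (.tensor (.tensor Γ Φ) Ψ) (.tensor Γ (.tensor Φ Ψ))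
  | empty_tensor (Γ) : Same (.tensor .empty Γ) Γ
  | tensor_empty (Γ) : Same (.tensor Γ .empty) Γ

/-- Elementary planar isotopies: sliding juxtaposed diagrams past each other and straightening
a zigzag. -/
inductive Isotopy : Graph → Graph → Type
  | slide (Γ Φ Γ' Φ' : Graph) (h : Γ.src = Γ'.tgt) (h' : Φ.src = Φ'.tgt) :
      Isotopy (comp (tensor Γ Φ) (tensor Γ' Φ')) (tensor (comp Γ Γ') (comp Φ Φ'))
  | zigzag (d : Dir) :
      Isotopy (comp (tensor (cap d) (strand d)) (tensor (strand d) (cup d.flip))) (strand d)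
  | zagzig (d : Dir) :
      Isotopy (comp (tensor (strand d) (cap d.flip)) (tensor (cup d) (strand d))) (strand d)

/-- One upward strand. -/
abbrev id1 : Graph := strand .up

/-- Two upward strands. -/
abbrev id2 : Graph := tensor id1 id1

/-- The graph `S` on upward strands. -/
abbrev S₀ : Graph := S .up

/-- `S ∘ S`. -/
abbrev SS : Graph := comp S₀ S₀

/-- The circle whose left half is oriented downward. -/
abbrev circle : Graph := comp (cap .down) (cup .down)

/-- The partial closure on the left of a diagram with two upward strands. -/
abbrev closeL (Γ : Graph) : Graph :=
  comp (comp (tensor (cap .down) id1) (tensor (strand .down) Γ)) (tensor (cup .down) id1)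

/-- A diagram on `↑↑↓↓` with its two inner strands closed. -/
abbrev closeMid (Γ : Graph) : Graph :=
  comp (comp (tensor id1 (tensor (cap .up) (strand .down))) Γ)
    (tensor id1 (tensor (cup .up) (strand .down)))

/-- `(S ⊗ 1) ∘ (1 ⊗ S)`. -/
abbrev zS : Graph := comp (tensor S₀ id1) (tensor id1 S₀)

/-- `(S ⊗ 1) ∘ (1 ⊗ S) ∘ (S ⊗ 1)`. -/
abbrev sss : Graph := comp zS (tensor S₀ id1)

end Graph

open MOY.Graph

/-! ## Elementary and composite morphisms -/

/-- The formal direct sum `[m] Γ = Γ{1-m} ⊕ Γ{3-m} ⊕ ⋯ ⊕ Γ{m-1}`, as a family. -/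
def bracket (m : ℕ) (Γ : Graph) : Fin m → Graph × ℤ :=
  fun t => (Γ, 1 - (m : ℤ) + 2 * (t : ℕ))

/-- Names of the distinguished invertible arrows from a graph to a formal direct sum. -/
inductive Dec
  | lam
  | mu
  | phi
  | psi
  | nu
  | eta

/-- The source of a distinguished invertible arrow. -/
def Dec.dom : Dec → Graph
  | lam => circle
  | mu => closeL S₀
  | phi => SS
  | psi => SS
  | nu => closeMid (tensor S₀ (S .down))
  | eta => sss

/-- The number of summands in its target. -/
def Dec.card (n : ℕ) : Dec → ℕ
  | lam => n
  | mu => n - 1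
  | phi => 2
  | psi => 2
  | nu => n - 2 + 1
  | eta => 2

/-- The shifted summands of its target:
`λ : ○ ≅ [n]`, `μ : closeL S ≅ [n-1] id₁`, `φ, ψ : S ∘ S ≅ S{-1} ⊕ S{1}`,
`ν : closeMid (S ⊗ S^∨) ≅ (coev ∘ ev) ⊕ [n-2] (id₁ ⊗ id₁^∨)`,
`η : (S ⊗ 1) ∘ (1 ⊗ S) ∘ (S ⊗ 1) ≅ (S ⊗ 1) ⊕ T`. -/
def Dec.piece (n : ℕ) : (D : Dec) → Fin (D.card n) → Graph × ℤ
  | lam => bracket n Graph.empty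
  | mu => bracket (n - 1) id1
  | phi => ![(S₀, -1), (S₀, 1)]
  | psi => ![(S₀, -1), (S₀, 1)]
  | nu => Fin.cons (Graph.comp (cup .up) (cap .up), 0)
      (bracket (n - 2) (Graph.tensor id1 (strand .down)))
  | eta => ![(Graph.tensor S₀ id1, 0), (T .up, 0)]

/-- Expressions for morphisms between shifted graphs: `Arr n Γ Δ d` consists of the expressions
for morphisms `Γ{m} → Δ{m + d}`; a morphism and its shifts are denoted by the same expression.
They are generated by the elementary arrows under linear combinations, composition, vertical
composition, juxtaposition and reflection. An invertible arrow to a formal direct sum is given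
by its components `proj`, and its inverse by the components `incl`. -/
inductive Arr (n : ℕ) : Graph → Graph → ℤ → Type
  | same {Γ Δ : Graph} (h : Same Γ Δ) : Arr n Γ Δ 0
  | iso {Γ Δ : Graph} (h : Isotopy Γ Δ) : Arr n Γ Δ 0
  | isoInv {Γ Δ : Graph} (h : Isotopy Γ Δ) : Arr n Δ Γ 0
  | iu (Γ : Graph) (w : Word) (h : Γ.tgt = w) : Arr n Γ (.comp (idWord w) Γ) 0
  | iuInv (Γ : Graph) (w : Word) (h : Γ.tgt = w) : Arr n (.comp (idWord w) Γ) Γ 0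
  | idn (Γ : Graph) (w : Word) (h : Γ.src = w) : Arr n Γ (.comp Γ (idWord w)) 0
  | idnInv (Γ : Graph) (w : Word) (h : Γ.src = w) : Arr n (.comp Γ (idWord w)) Γ 0
  | chi0 : Arr n id2 S₀ 1
  | chi1 : Arr n S₀ id2 1
  | eps : Arr n id1 id1 2
  | alpha : Arr n S₀ S₀ 2
  | gamma : Arr n S₀ S₀ 2
  | proj (D : Dec) (t : Fin (D.card n)) : Arr n D.dom (D.piece n t).1 (D.piece n t).2
  | incl (D : Dec) (t : Fin (D.card n)) : Arr n (D.piece n t).1 D.dom (-(D.piece n t).2)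
  | zero {Γ Δ : Graph} {d : ℤ} : Arr n Γ Δ d
  | add {Γ Δ : Graph} {d : ℤ} (f g : Arr n Γ Δ d) : Arr n Γ Δ d
  | smul {Γ Δ : Graph} {d : ℤ} (q : ℚ) (f : Arr n Γ Δ d) : Arr n Γ Δ d
  | comp {Γ Δ Θ : Graph} {d e k : ℤ} (f : Arr n Γ Δ d) (g : Arr n Δ Θ e) (h : d + e = k) :
      Arr n Γ Θ k
  | vcomp {Γ Γ' Φ Φ' : Graph} {d e k : ℤ} (f : Arr n Γ Γ' d) (g : Arr n Φ Φ' e)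
      (h : d + e = k) : Arr n (.comp Γ Φ) (.comp Γ' Φ') k
  | tensor {Γ Γ' Φ Φ' : Graph} {d e k : ℤ} (f : Arr n Γ Γ' d) (g : Arr n Φ Φ' e)
      (h : d + e = k) : Arr n (.tensor Γ Φ) (.tensor Γ' Φ') k
  | lr {Γ Δ : Graph} {d : ℤ} (f : Arr n Γ Δ d) : Arr n Γ.lr Δ.lr d
  | ud {Γ Δ : Graph} {d : ℤ} (f : Arr n Γ Δ d) : Arr n Γ.ud Δ.ud d

namespace Arr

variable {n : ℕ}

/-- The identity arrow. -/
abbrev one (Γ : Graph) : Arr n Γ Γ 0 := same (.refl Γ)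

/-- Composition (first `f`, then `g`), in the sum of the degrees. -/
abbrev seq {Γ Δ Θ : Graph} {d e : ℤ} (f : Arr n Γ Δ d) (g : Arr n Δ Θ e) :
    Arr n Γ Θ (d + e) := comp f g rfl

/-- `1 ∘ f`. -/
abbrev whiskerTop (Γ : Graph) {Φ Φ' : Graph} {d : ℤ} (f : Arr n Φ Φ' d) :
    Arr n (.comp Γ Φ) (.comp Γ Φ') d := vcomp (one Γ) f (zero_add d)

/-- `f ∘ 1`. -/
abbrev whiskerBot {Γ Γ' : Graph} {d : ℤ} (f : Arr n Γ Γ' d) (Φ : Graph) :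
    Arr n (.comp Γ Φ) (.comp Γ' Φ) d := vcomp f (one Φ) (add_zero d)

/-- `1 ⊗ f`. -/
abbrev tensorL (Γ : Graph) {Φ Φ' : Graph} {d : ℤ} (f : Arr n Φ Φ' d) :
    Arr n (.tensor Γ Φ) (.tensor Γ Φ') d := tensor (one Γ) f (zero_add d)

/-- `f ⊗ 1`. -/
abbrev tensorR {Γ Γ' : Graph} {d : ℤ} (f : Arr n Γ Γ' d) (Φ : Graph) :
    Arr n (.tensor Γ Φ) (.tensor Γ' Φ) d := tensor f (one Φ) (add_zero d)

/-- A finite sum of arrows. -/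
def sum {Γ Δ : Graph} {d : ℤ} {m : ℕ} (f : Fin m → Arr n Γ Δ d) : Arr n Γ Δ d :=
  (List.ofFn f).foldr add zero

/-- `χ₀ ∘ 1 : S → S ∘ S`, the insertion of an identity on top being included. -/
abbrev chiTop : Arr n S₀ SS 1 :=
  comp (iu S₀ [.up, .up] rfl) (whiskerBot chi0 S₀) (by norm_num)

/-- `1 ∘ χ₀ : S → S ∘ S`, the insertion of an identity at the bottom being included. -/
abbrev chiBot : Arr n S₀ SS 1 :=
  comp (idn S₀ [.up, .up] rfl) (whiskerTop S₀ chi0) (by norm_num)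

/-- `χ₀ ∘ 1 : id₂ → S ∘ id₂ = S`, insertion and removal of identities being included. -/
abbrev chiFirst : Arr n id2 S₀ 1 :=
  comp (comp (iu id2 [.up, .up] rfl) (whiskerBot chi0 id2) (by norm_num : (0 : ℤ) + 1 = 1))
    (idnInv S₀ [.up, .up] rfl) (by norm_num)

/-- `1 ∘ χ₁ : S ∘ S → S ∘ id₂ = S`. -/
abbrev chi1Bot : Arr n SS S₀ 1 :=
  comp (whiskerTop S₀ chi1) (idnInv S₀ [.up, .up] rfl) (by norm_num)

/-- The closure on the left of an arrow. -/
abbrev closeLMap {Γ Γ' : Graph} {d : ℤ} (f : Arr n Γ Γ' d) : Arr n (closeL Γ) (closeL Γ') d :=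
  whiskerBot (whiskerTop _ (tensorL (strand .down) f)) _

/-- The identification `closeL id₂ ≅ ○ ⊗ id₁`. -/
abbrev closeLId : Arr n (closeL id2) (.tensor circle id1) 0 :=
  comp (same (.comp_assoc _ _ _))
    (comp (whiskerTop _ (iuInv (.tensor (cup .down) id1) [.down, .up, .up] rfl))
      (comp (iso (.slide (cap .down) id1 (cup .down) id1 rfl rfl))
        (tensorL circle (idnInv id1 [.up] rfl)) (zero_add 0)) (zero_add 0)) (zero_add 0)

/-- The closure of the two inner strands of an arrow. -/
abbrev closeMidMap {Γ Γ' : Graph} {d : ℤ} (f : Arr n Γ Γ' d) :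
    Arr n (closeMid Γ) (closeMid Γ') d :=
  whiskerBot (whiskerTop _ f) _

/-- The identification `closeMid (id₂ ⊗ S^∨) ≅ id₁ ⊗ (closure of S^∨ on the left)`. -/
abbrev closeMidLeft : Arr n (closeMid (.tensor id2 (S .down)))
    (.tensor id1 (closeL S₀).ud) 0 :=
  comp (same (.comp (.comp (.refl _) (.tensor_assoc _ _ _)) (.refl _)))
    (comp (whiskerBot (iso (.slide id1 (.tensor (cap .up) (strand .down))
        id1 (.tensor (strand .up) (S .down)) rfl rfl)) _)
      (comp (iso (.slide (.comp id1 id1)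
          (.comp (.tensor (cap .up) (strand .down)) (.tensor (strand .up) (S .down)))
          id1 (.tensor (cup .up) (strand .down)) rfl rfl))
        (tensor (comp (idnInv (.comp id1 id1) [.up] rfl) (idnInv id1 [.up] rfl) (zero_add 0))
          (same (.comp_assoc _ _ _)) (zero_add 0))
        (zero_add 0)) (zero_add 0)) (zero_add 0)

/-- The identification `closeMid (S ⊗ id₂^∨) ≅ (closure of S on the right) ⊗ id₁^∨`. -/
abbrev closeMidRight : Arr n (closeMid (.tensor S₀ id2.ud))
    (.tensor (closeL S₀).lr (strand .down)) 0 :=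
  comp (same (.comp (.comp (.symm (.tensor_assoc _ _ _)) (.symm (.tensor_assoc _ _ _)))
      (.symm (.tensor_assoc _ _ _))))
    (comp (whiskerBot (iso (.slide (.tensor id1 (cap .up)) (strand .down)
        (.tensor S₀ (strand .down)) (strand .down) rfl rfl)) _)
      (comp (iso (.slide (.comp (.tensor id1 (cap .up)) (.tensor S₀ (strand .down)))
          (.comp (strand .down) (strand .down))
          (.tensor id1 (cup .up)) (strand .down) rfl rfl))
        (tensor (one _)
          (comp (idnInv (.comp (strand .down) (strand .down)) [.down] rfl)
            (idnInv (strand .down) [.down] rfl) (zero_add 0)) (zero_add 0))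
        (zero_add 0)) (zero_add 0)) (zero_add 0)

end Arr

open MOY.Arr

/-! ## Relations -/

/-- Names of those defining relations between elementary arrows that may be imposed or not.
Imposing all of them gives the full list of relations. -/
inductive Extra
  | chi1chi0
  | moyEps
  | moyChi0
  | moyChi1
  | alphaDef
  | moyChi0a
  | moyChi0b
  | moyZ
  | moy2d
  | moyNu1
  | moyNu2
  | moyEta
  | reflSymm

/-- The relations on morphisms. A constructor with a hypothesis `… ∈ E` is a relation that is
imposed only when its name belongs to `E`; all other relations are always imposed. -/
inductive Rel (n : ℕ) (E : Set Extra) :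
    {Γ Δ : Graph} → {d : ℤ} → Arr n Γ Δ d → Arr n Γ Δ d → Prop
  -- congruence
  | refl {Γ Δ d} (f : Arr n Γ Δ d) : Rel n E f f
  | add {Γ Δ d} {f f' g g' : Arr n Γ Δ d} :
      Rel n E f f' → Rel n E g g' → Rel n E (.add f g) (.add f' g')
  | smul {Γ Δ d} (q : ℚ) {f f' : Arr n Γ Δ d} : Rel n E f f' → Rel n E (.smul q f) (.smul q f')
  | comp {Γ Δ Θ d e k} {f f' : Arr n Γ Δ d} {g g' : Arr n Δ Θ e} (h : d + e = k) :
      Rel n E f f' → Rel n E g g' → Rel n E (.comp f g h) (.comp f' g' h)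
  | vcomp {Γ Γ' Φ Φ' d e k} {f f' : Arr n Γ Γ' d} {g g' : Arr n Φ Φ' e} (h : d + e = k) :
      Rel n E f f' → Rel n E g g' → Rel n E (.vcomp f g h) (.vcomp f' g' h)
  | tensor {Γ Γ' Φ Φ' d e k} {f f' : Arr n Γ Γ' d} {g g' : Arr n Φ Φ' e} (h : d + e = k) :
      Rel n E f f' → Rel n E g g' → Rel n E (.tensor f g h) (.tensor f' g' h)
  | lr {Γ Δ d} {f f' : Arr n Γ Δ d} : Rel n E f f' → Rel n E (.lr f) (.lr f')
  | ud {Γ Δ d} {f f' : Arr n Γ Δ d} : Rel n E f f' → Rel n E (.ud f) (.ud f')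
  -- morphisms form rational vector spaces
  | add_assoc {Γ Δ d} (f g k : Arr n Γ Δ d) : Rel n E (.add (.add f g) k) (.add f (.add g k))
  | add_comm {Γ Δ d} (f g : Arr n Γ Δ d) : Rel n E (.add f g) (.add g f)
  | zero_add {Γ Δ d} (f : Arr n Γ Δ d) : Rel n E (.add .zero f) f
  | neg_add {Γ Δ d} (f : Arr n Γ Δ d) : Rel n E (.add (.smul (-1) f) f) .zero
  | smul_add {Γ Δ d} (q : ℚ) (f g : Arr n Γ Δ d) :
      Rel n E (.smul q (.add f g)) (.add (.smul q f) (.smul q g))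
  | add_smul {Γ Δ d} (q r : ℚ) (f : Arr n Γ Δ d) :
      Rel n E (.smul (q + r) f) (.add (.smul q f) (.smul r f))
  | mul_smul {Γ Δ d} (q r : ℚ) (f : Arr n Γ Δ d) :
      Rel n E (.smul (q * r) f) (.smul q (.smul r f))
  | one_smul {Γ Δ d} (f : Arr n Γ Δ d) : Rel n E (.smul 1 f) f
  -- composition
  | one_comp {Γ Δ d} (f : Arr n Γ Δ d) : Rel n E (.comp (one Γ) f (_root_.zero_add d)) f
  | comp_one {Γ Δ d} (f : Arr n Γ Δ d) : Rel n E (.comp f (one Δ) (_root_.add_zero d)) f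
  | comp_assoc {Γ Δ Θ Ξ a b c ab bc abc} (f : Arr n Γ Δ a) (g : Arr n Δ Θ b) (k : Arr n Θ Ξ c)
      (h₁ : a + b = ab) (h₂ : ab + c = abc) (h₃ : b + c = bc) (h₄ : a + bc = abc) :
      Rel n E (.comp (.comp f g h₁) k h₂) (.comp f (.comp g k h₃) h₄)
  | add_comp {Γ Δ Θ d e k} (f f' : Arr n Γ Δ d) (g : Arr n Δ Θ e) (h : d + e = k) :
      Rel n E (.comp (.add f f') g h) (.add (.comp f g h) (.comp f' g h))
  | comp_add {Γ Δ Θ d e k} (f : Arr n Γ Δ d) (g g' : Arr n Δ Θ e) (h : d + e = k) :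
      Rel n E (.comp f (.add g g') h) (.add (.comp f g h) (.comp f g' h))
  | smul_comp {Γ Δ Θ d e k} (q : ℚ) (f : Arr n Γ Δ d) (g : Arr n Δ Θ e) (h : d + e = k) :
      Rel n E (.comp (.smul q f) g h) (.smul q (.comp f g h))
  | comp_smul {Γ Δ Θ d e k} (q : ℚ) (f : Arr n Γ Δ d) (g : Arr n Δ Θ e) (h : d + e = k) :
      Rel n E (.comp f (.smul q g) h) (.smul q (.comp f g h))
  -- vertical composition
  | vcomp_one (Γ Φ : Graph) :
      Rel n E (.vcomp (one Γ) (one Φ) (_root_.zero_add 0)) (one (.comp Γ Φ))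
  | vcomp_comp {Γ Γ' Γ'' Φ Φ' Φ'' a b c d ab cd ac bd k}
      (f : Arr n Γ Γ' a) (f' : Arr n Γ' Γ'' b) (g : Arr n Φ Φ' c) (g' : Arr n Φ' Φ'' d)
      (h₁ : a + b = ab) (h₂ : c + d = cd) (h₃ : ab + cd = k)
      (h₄ : a + c = ac) (h₅ : b + d = bd) (h₆ : ac + bd = k) :
      Rel n E (.vcomp (.comp f f' h₁) (.comp g g' h₂) h₃)
        (.comp (.vcomp f g h₄) (.vcomp f' g' h₅) h₆)
  | add_vcomp {Γ Γ' Φ Φ' d e k} (f f' : Arr n Γ Γ' d) (g : Arr n Φ Φ' e) (h : d + e = k) :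
      Rel n E (.vcomp (.add f f') g h) (.add (.vcomp f g h) (.vcomp f' g h))
  | vcomp_add {Γ Γ' Φ Φ' d e k} (f : Arr n Γ Γ' d) (g g' : Arr n Φ Φ' e) (h : d + e = k) :
      Rel n E (.vcomp f (.add g g') h) (.add (.vcomp f g h) (.vcomp f g' h))
  | smul_vcomp {Γ Γ' Φ Φ' d e k} (q : ℚ) (f : Arr n Γ Γ' d) (g : Arr n Φ Φ' e)
      (h : d + e = k) : Rel n E (.vcomp (.smul q f) g h) (.smul q (.vcomp f g h))
  | vcomp_smul {Γ Γ' Φ Φ' d e k} (q : ℚ) (f : Arr n Γ Γ' d) (g : Arr n Φ Φ' e)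
      (h : d + e = k) : Rel n E (.vcomp f (.smul q g) h) (.smul q (.vcomp f g h))
  | vcomp_assoc {Γ Γ' Φ Φ' Ψ Ψ' a b c ab bc k}
      (f : Arr n Γ Γ' a) (g : Arr n Φ Φ' b) (l : Arr n Ψ Ψ' c)
      (h₁ : a + b = ab) (h₂ : ab + c = k) (h₃ : b + c = bc) (h₄ : a + bc = k) :
      Rel n E (.comp (.vcomp (.vcomp f g h₁) l h₂) (.same (.comp_assoc Γ' Φ' Ψ')) (_root_.add_zero k))
        (.comp (.same (.comp_assoc Γ Φ Ψ)) (.vcomp f (.vcomp g l h₃) h₄) (_root_.zero_add k))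
  -- juxtaposition
  | tensor_one (Γ Φ : Graph) :
      Rel n E (.tensor (one Γ) (one Φ) (_root_.zero_add 0)) (one (.tensor Γ Φ))
  | tensor_comp {Γ Γ' Γ'' Φ Φ' Φ'' a b c d ab cd ac bd k}
      (f : Arr n Γ Γ' a) (f' : Arr n Γ' Γ'' b) (g : Arr n Φ Φ' c) (g' : Arr n Φ' Φ'' d)
      (h₁ : a + b = ab) (h₂ : c + d = cd) (h₃ : ab + cd = k)
      (h₄ : a + c = ac) (h₅ : b + d = bd) (h₆ : ac + bd = k) :
      Rel n E (.tensor (.comp f f' h₁) (.comp g g' h₂) h₃)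
        (.comp (.tensor f g h₄) (.tensor f' g' h₅) h₆)
  | add_tensor {Γ Γ' Φ Φ' d e k} (f f' : Arr n Γ Γ' d) (g : Arr n Φ Φ' e) (h : d + e = k) :
      Rel n E (.tensor (.add f f') g h) (.add (.tensor f g h) (.tensor f' g h))
  | tensor_add {Γ Γ' Φ Φ' d e k} (f : Arr n Γ Γ' d) (g g' : Arr n Φ Φ' e) (h : d + e = k) :
      Rel n E (.tensor f (.add g g') h) (.add (.tensor f g h) (.tensor f g' h))
  | smul_tensor {Γ Γ' Φ Φ' d e k} (q : ℚ) (f : Arr n Γ Γ' d) (g : Arr n Φ Φ' e)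
      (h : d + e = k) : Rel n E (.tensor (.smul q f) g h) (.smul q (.tensor f g h))
  | tensor_smul {Γ Γ' Φ Φ' d e k} (q : ℚ) (f : Arr n Γ Γ' d) (g : Arr n Φ Φ' e)
      (h : d + e = k) : Rel n E (.tensor f (.smul q g) h) (.smul q (.tensor f g h))
  | tensor_assoc {Γ Γ' Φ Φ' Ψ Ψ' a b c ab bc k}
      (f : Arr n Γ Γ' a) (g : Arr n Φ Φ' b) (l : Arr n Ψ Ψ' c)
      (h₁ : a + b = ab) (h₂ : ab + c = k) (h₃ : b + c = bc) (h₄ : a + bc = k) :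
      Rel n E
        (.comp (.tensor (.tensor f g h₁) l h₂) (.same (.tensor_assoc Γ' Φ' Ψ')) (_root_.add_zero k))
        (.comp (.same (.tensor_assoc Γ Φ Ψ)) (.tensor f (.tensor g l h₃) h₄) (_root_.zero_add k))
  | empty_tensor {Γ Δ d} (f : Arr n Γ Δ d) :
      Rel n E (.comp (tensorL .empty f) (.same (.empty_tensor Δ)) (_root_.add_zero d))
        (.comp (.same (.empty_tensor Γ)) f (_root_.zero_add d))
  | tensor_empty {Γ Δ d} (f : Arr n Γ Δ d) :
      Rel n E (.comp (tensorR f .empty) (.same (.tensor_empty Δ)) (_root_.add_zero d))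
        (.comp (.same (.tensor_empty Γ)) f (_root_.zero_add d))
  -- identification of equal diagrams
  | same_same {Γ Δ Θ} (h : Same Γ Δ) (h' : Same Δ Θ) :
      Rel n E (.comp (.same h) (.same h') (_root_.zero_add 0)) (.same (h.trans h'))
  | same_vcomp {Γ Γ' Φ Φ'} (h : Same Γ Γ') (h' : Same Φ Φ') :
      Rel n E (.vcomp (.same h) (.same h') (_root_.zero_add 0)) (.same (h.comp h'))
  | same_tensor {Γ Γ' Φ Φ'} (h : Same Γ Γ') (h' : Same Φ Φ') :
      Rel n E (.tensor (.same h) (.same h') (_root_.zero_add 0)) (.same (h.tensor h'))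
  -- planar isotopies are invertible, and sliding is natural
  | iso_isoInv {Γ Δ} (h : Isotopy Γ Δ) :
      Rel n E (.comp (.iso h) (.isoInv h) (_root_.zero_add 0)) (one Γ)
  | isoInv_iso {Γ Δ} (h : Isotopy Γ Δ) :
      Rel n E (.comp (.isoInv h) (.iso h) (_root_.zero_add 0)) (one Δ)
  | slide_naturality {Γ₁ Γ₁' Φ₁ Φ₁' Γ₂ Γ₂' Φ₂ Φ₂' a b c d ab cd ac bd k}
      (f₁ : Arr n Γ₁ Γ₂ a) (g₁ : Arr n Φ₁ Φ₂ b) (f₂ : Arr n Γ₁' Γ₂' c) (g₂ : Arr n Φ₁' Φ₂' d)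
      (h₁ : a + b = ab) (h₂ : c + d = cd) (h₃ : ab + cd = k)
      (h₄ : a + c = ac) (h₅ : b + d = bd) (h₆ : ac + bd = k)
      (e₁ : Γ₁.src = Γ₁'.tgt) (e₂ : Φ₁.src = Φ₁'.tgt)
      (e₃ : Γ₂.src = Γ₂'.tgt) (e₄ : Φ₂.src = Φ₂'.tgt) :
      Rel n E
        (.comp (.vcomp (.tensor f₁ g₁ h₁) (.tensor f₂ g₂ h₂) h₃)
          (.iso (.slide Γ₂ Φ₂ Γ₂' Φ₂' e₃ e₄)) (_root_.add_zero k))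
        (.comp (.iso (.slide Γ₁ Φ₁ Γ₁' Φ₁' e₁ e₂))
          (.tensor (.vcomp f₁ f₂ h₄) (.vcomp g₁ g₂ h₅) h₆) (_root_.zero_add k))
  -- insertion of identities is invertible, natural and satisfies the triangle identity
  | iu_iuInv (Γ w h) : Rel n E (.comp (.iu Γ w h) (.iuInv Γ w h) (_root_.zero_add 0)) (one Γ)
  | iuInv_iu (Γ w h) : Rel n E (.comp (.iuInv Γ w h) (.iu Γ w h) (_root_.zero_add 0)) (one _)
  | idn_idnInv (Γ w h) : Rel n E (.comp (.idn Γ w h) (.idnInv Γ w h) (_root_.zero_add 0)) (one Γ)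
  | idnInv_idn (Γ w h) : Rel n E (.comp (.idnInv Γ w h) (.idn Γ w h) (_root_.zero_add 0)) (one _)
  | iu_naturality {Γ Δ d} (f : Arr n Γ Δ d) (w h h') :
      Rel n E (.comp f (.iu Δ w h') (_root_.add_zero d))
        (.comp (.iu Γ w h) (whiskerTop (idWord w) f) (_root_.zero_add d))
  | idn_naturality {Γ Δ d} (f : Arr n Γ Δ d) (w h h') :
      Rel n E (.comp f (.idn Δ w h') (_root_.add_zero d))
        (.comp (.idn Γ w h) (whiskerBot f (idWord w)) (_root_.zero_add d))
  | triangle (Φ Γ w h h') :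
      Rel n E (.comp (whiskerBot (.idn Φ w h) Γ) (.same (.comp_assoc Φ (idWord w) Γ))
        (_root_.zero_add 0)) (whiskerTop Φ (.iu Γ w h'))
  -- the distinguished arrows to direct sums are invertible
  | incl_proj (D : Dec) (t : Fin (D.card n)) :
      Rel n E (.comp (.incl D t) (.proj D t) (neg_add_cancel _)) (one _)
  | incl_proj_ne (D : Dec) (s t : Fin (D.card n)) (hst : s ≠ t) :
      Rel n E (seq (.incl D s) (.proj D t)) .zero
  | sum_proj_incl (D : Dec) :
      Rel n E (Arr.sum fun t => .comp (.proj D t) (.incl D t) (add_neg_cancel _)) (one D.dom)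
  -- reflection is compatible with all operations
  | lr_add {Γ Δ d} (f g : Arr n Γ Δ d) : Rel n E (.lr (.add f g)) (.add (.lr f) (.lr g))
  | lr_smul {Γ Δ d} (q) (f : Arr n Γ Δ d) : Rel n E (.lr (.smul q f)) (.smul q (.lr f))
  | lr_comp {Γ Δ Θ d e k} (f : Arr n Γ Δ d) (g : Arr n Δ Θ e) (h : d + e = k) :
      Rel n E (.lr (.comp f g h)) (.comp (.lr f) (.lr g) h)
  | lr_vcomp {Γ Γ' Φ Φ' d e k} (f : Arr n Γ Γ' d) (g : Arr n Φ Φ' e) (h : d + e = k) :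
      Rel n E (.lr (.vcomp f g h)) (.vcomp (.lr f) (.lr g) h)
  | lr_tensor {Γ Γ' Φ Φ' d e k} (f : Arr n Γ Γ' d) (g : Arr n Φ Φ' e) (h : d + e = k)
      (h' : e + d = k) : Rel n E (.lr (.tensor f g h)) (.tensor (.lr g) (.lr f) h')
  | lr_same {Γ Δ} (h : Same Γ Δ) (h' : Same Γ.lr Δ.lr) : Rel n E (.lr (.same h)) (.same h')
  | lr_iu (Γ w h v) (h' : Γ.lr.tgt = v) (s : Same (idWord v) (idWord w).lr) :
      Rel n E (.lr (.iu Γ w h))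
        (.comp (.iu Γ.lr v h') (whiskerBot (.same s) Γ.lr) (_root_.zero_add 0))
  | lr_idn (Γ w h v) (h' : Γ.lr.src = v) (s : Same (idWord v) (idWord w).lr) :
      Rel n E (.lr (.idn Γ w h))
        (.comp (.idn Γ.lr v h') (whiskerTop Γ.lr (.same s)) (_root_.zero_add 0))
  | lr_lr {Γ Δ d} (f : Arr n Γ Δ d) (h : Same Γ.lr.lr Γ) (h' : Same Δ Δ.lr.lr) :
      Rel n E (.lr (.lr f))
        (.comp (.same h) (.comp f (.same h') (_root_.add_zero d)) (_root_.zero_add d))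
  | ud_add {Γ Δ d} (f g : Arr n Γ Δ d) : Rel n E (.ud (.add f g)) (.add (.ud f) (.ud g))
  | ud_smul {Γ Δ d} (q) (f : Arr n Γ Δ d) : Rel n E (.ud (.smul q f)) (.smul q (.ud f))
  | ud_comp {Γ Δ Θ d e k} (f : Arr n Γ Δ d) (g : Arr n Δ Θ e) (h : d + e = k) :
      Rel n E (.ud (.comp f g h)) (.comp (.ud f) (.ud g) h)
  | ud_vcomp {Γ Γ' Φ Φ' d e k} (f : Arr n Γ Γ' d) (g : Arr n Φ Φ' e) (h : d + e = k)
      (h' : e + d = k) : Rel n E (.ud (.vcomp f g h)) (.vcomp (.ud g) (.ud f) h')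
  | ud_tensor {Γ Γ' Φ Φ' d e k} (f : Arr n Γ Γ' d) (g : Arr n Φ Φ' e) (h : d + e = k) :
      Rel n E (.ud (.tensor f g h)) (.tensor (.ud f) (.ud g) h)
  | ud_same {Γ Δ} (h : Same Γ Δ) (h' : Same Γ.ud Δ.ud) : Rel n E (.ud (.same h)) (.same h')
  | ud_iu (Γ w h v) (h' : Γ.ud.src = v) (s : Same (idWord v) (idWord w).ud) :
      Rel n E (.ud (.iu Γ w h))
        (.comp (.idn Γ.ud v h') (whiskerTop Γ.ud (.same s)) (_root_.zero_add 0))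
  | ud_idn (Γ w h v) (h' : Γ.ud.tgt = v) (s : Same (idWord v) (idWord w).ud) :
      Rel n E (.ud (.idn Γ w h))
        (.comp (.iu Γ.ud v h') (whiskerBot (.same s) Γ.ud) (_root_.zero_add 0))
  | ud_ud {Γ Δ d} (f : Arr n Γ Δ d) (h : Same Γ.ud.ud Γ) (h' : Same Δ Δ.ud.ud) :
      Rel n E (.ud (.ud f))
        (.comp (.same h) (.comp f (.same h') (_root_.add_zero d)) (_root_.zero_add d))
  | ud_lr {Γ Δ d} (f : Arr n Γ Δ d) (h : Same Γ.lr.ud Γ.ud.lr) (h' : Same Δ.ud.lr Δ.lr.ud) :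
      Rel n E (.ud (.lr f))
        (.comp (.same h) (.comp (.lr (.ud f)) (.same h') (_root_.add_zero d)) (_root_.zero_add d))
  -- (moy2a), (moy2b), (moy2c), (shift1), (shift2), componentwise
  | moy2a_fst : Rel n E (.comp chiBot (.proj .phi (0 : Fin 2)) (add_neg_cancel 1)) (one S₀)
  | moy2a_snd : Rel n E (.comp chiBot (.proj .phi (1 : Fin 2)) (one_add_one_eq_two)) .zero
  | moy2b_fst : Rel n E (.comp chiTop (.proj .phi (0 : Fin 2)) (add_neg_cancel 1)) (one S₀)
  | moy2b_snd : Rel n E (.comp chiTop (.proj .phi (1 : Fin 2)) (one_add_one_eq_two)) .alpha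
  | moy2c_fst : Rel n E (.comp chiTop (.proj .psi (0 : Fin 2)) (add_neg_cancel 1)) (one S₀)
  | moy2c_snd : Rel n E (.comp chiTop (.proj .psi (1 : Fin 2)) (one_add_one_eq_two)) .gamma
  | shift1_fst (h : (2 : ℤ) + -1 = 1) :
      Rel n E (.comp (whiskerTop S₀ .alpha) (.proj .psi (0 : Fin 2)) h)
        (.proj .phi (1 : Fin 2))
  | shift1_snd (h : (2 : ℤ) + 1 = 3) :
      Rel n E (.comp (whiskerTop S₀ .alpha) (.proj .psi (1 : Fin 2)) h) .zero
  | shift2_fst (h : (2 : ℤ) + -1 = 1) :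
      Rel n E (.comp (whiskerTop S₀ .gamma) (.proj .phi (0 : Fin 2)) h)
        (.proj .psi (1 : Fin 2))
  | shift2_snd (h : (2 : ℤ) + 1 = 3) :
      Rel n E (.comp (whiskerTop S₀ .gamma) (.proj .phi (1 : Fin 2)) h) .zero
  -- `χ₁ χ₀ = 0`
  | chi1chi0 (_ : Extra.chi1chi0 ∈ E) : Rel n E (seq .chi0 .chi1) .zero
  -- `λ ε = (0 1; 0 0) λ : ○{-1} → [n-1] ⊕ ℚ{n}`
  | moyEps (_ : Extra.moyEps ∈ E) (t t' : Fin n) (ht : (t' : ℕ) = t + 1)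
      (h : 2 + (1 - (n : ℤ) + 2 * (t : ℕ)) = 1 - (n : ℤ) + 2 * (t' : ℕ)) :
      Rel n E
        (.comp (.comp (whiskerTop (cap .down) (.iu (cup .down) [.down, .up] rfl))
            (.comp (whiskerTop (cap .down)
                (whiskerBot (tensorL (strand .down) .eps) (cup .down)))
              (whiskerTop (cap .down) (.iuInv (cup .down) [.down, .up] rfl))
              (_root_.add_zero 2)) (_root_.zero_add 2))
          (.proj .lam t) h)
        (.proj .lam t')
  | moyEps_last (_ : Extra.moyEps ∈ E) (t : Fin n) (ht : (t : ℕ) + 1 = n) :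
      Rel n E
        (seq (.comp (whiskerTop (cap .down) (.iu (cup .down) [.down, .up] rfl))
            (.comp (whiskerTop (cap .down)
                (whiskerBot (tensorL (strand .down) .eps) (cup .down)))
              (whiskerTop (cap .down) (.iuInv (cup .down) [.down, .up] rfl))
              (_root_.add_zero 2)) (_root_.zero_add 2))
          (.proj .lam t))
        .zero
  -- `μ (1 ⊗ χ₀) = (0 1) (λ ⊗ 1) : ○ ⊗ id₁ → [n-1] id₁ {1}`
  | moyChi0 (_ : Extra.moyChi0 ∈ E) (t : Fin (n - 1)) (t' : Fin n) (ht : (t' : ℕ) = t + 1)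
      (h : 1 + (1 - ((n - 1 : ℕ) : ℤ) + 2 * (t : ℕ)) = 1 - (n : ℤ) + 2 * (t' : ℕ)) :
      Rel n E
        (.comp (closeLMap .chi0) (.proj .mu t) h)
        (.comp closeLId (.comp (tensorR (.proj .lam t') id1) (.same (.empty_tensor id1))
          (_root_.add_zero _)) (_root_.zero_add _))
  -- `(λ ⊗ 1) (1 ⊗ χ₁) = (1; 0) μ : closeL S {-1} → [n-1] id₁ {-1} ⊕ id₁ {n-1}`
  | moyChi1 (_ : Extra.moyChi1 ∈ E) (t : Fin (n - 1)) (t' : Fin n) (ht : (t' : ℕ) = t)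
      (h : 1 + (1 - (n : ℤ) + 2 * (t' : ℕ)) = 1 - ((n - 1 : ℕ) : ℤ) + 2 * (t : ℕ)) :
      Rel n E
        (.comp (closeLMap .chi1)
          (.comp closeLId (.comp (tensorR (.proj .lam t') id1) (.same (.empty_tensor id1))
            (_root_.add_zero _)) (_root_.zero_add _)) h)
        (.proj .mu t)
  | moyChi1_last (_ : Extra.moyChi1 ∈ E) (t' : Fin n) (ht : (t' : ℕ) + 1 = n) :
      Rel n E
        (seq (closeLMap .chi1)
          (.comp closeLId (.comp (tensorR (.proj .lam t') id1) (.same (.empty_tensor id1))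
            (_root_.add_zero _)) (_root_.zero_add _)))
        .zero
  -- `α = (1 ∘ χ₁) (χ₀ ∘ 1)`
  | alphaDef (_ : Extra.alphaDef ∈ E) :
      Rel n E (.comp chiTop chi1Bot one_add_one_eq_two) .alpha
  -- `μ (1 ⊗ α) = 0`
  | moyChi0a (_ : Extra.moyChi0a ∈ E) (t : Fin (n - 1)) :
      Rel n E (seq (closeLMap .alpha) (.proj .mu t)) .zero
  -- `μ (1 ⊗ γ) = ε μ`
  | moyChi0b (_ : Extra.moyChi0b ∈ E) (t : Fin (n - 1)) (k : ℤ)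
      (h : 2 + (Dec.mu.piece n t).2 = k) (h' : (Dec.mu.piece n t).2 + 2 = k) :
      Rel n E (.comp (closeLMap .gamma) (.proj .mu t) h) (.comp (.proj .mu t) .eps h')
  -- `(1_S ⊗ 1) ∘ (1 ⊗ χ₀) = 0`
  | moyZ (_ : Extra.moyZ ∈ E) :
      Rel n E (seq (.idn (.tensor S₀ id1) [.up, .up, .up] rfl)
        (whiskerTop (.tensor S₀ id1) (tensorL id1 .chi0))) .zero
  -- `1 ∘ χ₁ = (0 1) φ`
  | moy2d (_ : Extra.moy2d ∈ E) : Rel n E chi1Bot (.proj .phi (1 : Fin 2))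
  -- `ν (χ₀ ⊗ 1) = (0 0; 0 1) (1 ⊗ μ)`
  | moyNu1_fst (_ : Extra.moyNu1 ∈ E) :
      Rel n E (seq (closeMidMap (tensorR .chi0 (S .down)))
        (.proj .nu (0 : Fin (n - 2 + 1)))) .zero
  | moyNu1_snd (_ : Extra.moyNu1 ∈ E) (t : Fin (n - 2)) (t' : Fin (n - 1)) (ht : (t' : ℕ) = t + 1)
      (h : 1 + (1 - ((n - 2 : ℕ) : ℤ) + 2 * (t : ℕ)) = 1 - ((n - 1 : ℕ) : ℤ) + 2 * (t' : ℕ)) :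
      Rel n E
        (.comp (closeMidMap (tensorR .chi0 (S .down))) (.proj .nu (Fin.succ t : Fin (n - 2 + 1))) h)
        (.comp closeMidLeft (tensorL id1 (.ud (.proj .mu t'))) (_root_.zero_add _))
  -- `(μ ⊗ 1) (1 ⊗ χ₁) = (0 1; 0 0) ν`
  | moyNu2 (_ : Extra.moyNu2 ∈ E) (t : Fin (n - 2)) (t' : Fin (n - 1)) (ht : (t' : ℕ) = t)
      (h : 1 + (1 - ((n - 1 : ℕ) : ℤ) + 2 * (t' : ℕ)) = 1 - ((n - 2 : ℕ) : ℤ) + 2 * (t : ℕ)) :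
      Rel n E
        (.comp (closeMidMap (tensorL S₀ (.ud .chi1)))
          (.comp closeMidRight (tensorR (.lr (.proj .mu t')) (strand .down)) (_root_.zero_add _)) h)
        (.proj .nu (Fin.succ t : Fin (n - 2 + 1)))
  | moyNu2_last (_ : Extra.moyNu2 ∈ E) (t' : Fin (n - 1)) (ht : (t' : ℕ) + 1 = n - 1) :
      Rel n E
        (seq (closeMidMap (tensorL S₀ (.ud .chi1)))
          (.comp closeMidRight (tensorR (.lr (.proj .mu t')) (strand .down)) (_root_.zero_add _)))
        .zero
  -- `η (χ₀ ⊗ 1) = (χ₁; 0) : (S ⊗ 1) ∘ (1 ⊗ S) {-1} → (S ⊗ 1) ⊕ T`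
  | moyEta_fst (_ : Extra.moyEta ∈ E) :
      Rel n E
        (.comp (.comp (.idn zS [.up, .up, .up] rfl)
            (.comp (whiskerTop zS (.same (.symm (.tensor_assoc id1 id1 id1))))
              (whiskerTop zS (tensorR .chi0 id1)) (_root_.zero_add 1)) (_root_.zero_add 1))
          (.proj .eta (0 : Fin 2)) (_root_.add_zero 1))
        (.comp (whiskerTop (.tensor S₀ id1) (tensorL id1 .chi1))
          (.idnInv (.tensor S₀ id1) [.up, .up, .up] rfl) (_root_.add_zero 1))
  | moyEta_snd (_ : Extra.moyEta ∈ E) :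
      Rel n E
        (.comp (.comp (.idn zS [.up, .up, .up] rfl)
            (.comp (whiskerTop zS (.same (.symm (.tensor_assoc id1 id1 id1))))
              (whiskerTop zS (tensorR .chi0 id1)) (_root_.zero_add 1)) (_root_.zero_add 1))
          (.proj .eta (1 : Fin 2)) (_root_.add_zero 1))
        .zero
  -- a left-right mirror image that has the same source and target is the same arrow
  | lr_chi0 (_ : Extra.reflSymm ∈ E) : Rel n E (.lr .chi0) .chi0
  | lr_chi1 (_ : Extra.reflSymm ∈ E) : Rel n E (.lr .chi1) .chi1
  | lr_eps (_ : Extra.reflSymm ∈ E) : Rel n E (.lr .eps) .eps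
  | lr_alpha (_ : Extra.reflSymm ∈ E) : Rel n E (.lr .alpha) .alpha
  | lr_gamma (_ : Extra.reflSymm ∈ E) : Rel n E (.lr .gamma) .gamma
  | lr_phi0 (_ : Extra.reflSymm ∈ E) :
      Rel n E (.lr (.proj .phi (0 : Fin 2))) (.proj .phi (0 : Fin 2))
  | lr_phi1 (_ : Extra.reflSymm ∈ E) :
      Rel n E (.lr (.proj .phi (1 : Fin 2))) (.proj .phi (1 : Fin 2))
  | lr_psi0 (_ : Extra.reflSymm ∈ E) :
      Rel n E (.lr (.proj .psi (0 : Fin 2))) (.proj .psi (0 : Fin 2))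
  | lr_psi1 (_ : Extra.reflSymm ∈ E) :
      Rel n E (.lr (.proj .psi (1 : Fin 2))) (.proj .psi (1 : Fin 2))

/-! ## The category of formal direct sums of shifted graphs -/

/-- Morphisms `Γ{m} → Δ{m + d}` modulo the relations. -/
def GHom (n : ℕ) (E : Set Extra) (Γ Δ : Graph) (d : ℤ) : Type :=
  Quot (Rel n E (Γ := Γ) (Δ := Δ) (d := d))

namespace GHom

variable {n : ℕ} {E : Set Extra} {Γ Δ Θ : Graph} {d e k : ℤ}

/-- The class of an expression. -/
def mk (E : Set Extra) (f : Arr n Γ Δ d) : GHom n E Γ Δ d := Quot.mk _ f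

instance : Zero (GHom n E Γ Δ d) := ⟨mk E .zero⟩

instance : Add (GHom n E Γ Δ d) :=
  ⟨Quot.map₂ Arr.add (fun f _ _ h => .add (.refl f) h) (fun _ _ g h => .add h (.refl g))⟩

instance : SMul ℚ (GHom n E Γ Δ d) :=
  ⟨fun q => Quot.map (Arr.smul q) (fun _ _ h => .smul q h)⟩

instance : Neg (GHom n E Γ Δ d) := ⟨fun f => (-1 : ℚ) • f⟩

instance : AddCommGroup (GHom n E Γ Δ d) where
  add_assoc := by rintro ⟨f⟩ ⟨g⟩ ⟨k⟩; exact Quot.sound (.add_assoc f g k)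
  add_comm := by rintro ⟨f⟩ ⟨g⟩; exact Quot.sound (.add_comm f g)
  zero_add := by rintro ⟨f⟩; exact Quot.sound (.zero_add f)
  add_zero := by
    rintro ⟨f⟩
    exact (Quot.sound (.add_comm f .zero)).trans (Quot.sound (.zero_add f))
  neg_add_cancel := by rintro ⟨f⟩; exact Quot.sound (.neg_add f)
  nsmul := nsmulRec
  zsmul := zsmulRec

instance : Module ℚ (GHom n E Γ Δ d) :=
  Module.ofMinimalAxioms
    (by rintro q ⟨f⟩ ⟨g⟩; exact Quot.sound (.smul_add q f g))
    (by rintro q r ⟨f⟩; exact Quot.sound (.add_smul q r f))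
    (by rintro q r ⟨f⟩; exact Quot.sound (.mul_smul q r f))
    (by rintro ⟨f⟩; exact Quot.sound (.one_smul f))

/-- Composition (first `f`, then `g`). -/
def comp (f : GHom n E Γ Δ d) (g : GHom n E Δ Θ e) (h : d + e = k) : GHom n E Γ Θ k :=
  Quot.map₂ (fun f g => Arr.comp f g h) (fun f _ _ r => .comp h (.refl f) r)
    (fun _ _ g r => .comp h r (.refl g)) f g

/-- Change of the degree along an equality. -/
def cast (h : d = e) (f : GHom n E Γ Δ d) : GHom n E Γ Δ e := h ▸ f

end GHom

/-- A shifted MOY-type graph `Γ{m}` with source `i` and target `j`. -/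
structure ShGraph (n : ℕ) (E : Set Extra) (i j : Word) where
  graph : Graph
  wf : graph.WF
  src_eq : graph.src = i
  tgt_eq : graph.tgt = j
  shift : ℤ

namespace ShGraph

variable {n : ℕ} {E : Set Extra} {i j : Word}

/-- Morphisms between shifted graphs, up to the relations. -/
instance : Category (ShGraph n E i j) where
  Hom X Y := GHom n E X.graph Y.graph (Y.shift - X.shift)
  id X := GHom.cast (sub_self _).symm (GHom.mk E (one X.graph))
  comp {X Y Z} f g := GHom.comp f g (by ring)
  id_comp {X Y} := by
    have key : ∀ (k d : ℤ) (hk : (0 : ℤ) = k) (h : k + d = d)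
        (f : GHom n E X.graph Y.graph d),
        GHom.comp (GHom.cast hk (GHom.mk E (one X.graph))) f h = f := by
      rintro k d rfl h ⟨f⟩
      exact Quot.sound (.one_comp f)
    exact key _ _ _ _
  comp_id {X Y} := by
    have key : ∀ (k d : ℤ) (hk : (0 : ℤ) = k) (h : d + k = d)
        (f : GHom n E X.graph Y.graph d),
        GHom.comp f (GHom.cast hk (GHom.mk E (one Y.graph))) h = f := by
      rintro k d rfl h ⟨f⟩
      exact Quot.sound (.comp_one f)
    exact key _ _ _ _
  assoc := by
    rintro W X Y Z ⟨f⟩ ⟨g⟩ ⟨k⟩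
    exact Quot.sound (.comp_assoc f g k _ _ _ _)

instance : Preadditive (ShGraph n E i j) where
  homGroup X Y := inferInstanceAs (AddCommGroup (GHom n E X.graph Y.graph (Y.shift - X.shift)))
  add_comp := by
    rintro X Y Z ⟨f⟩ ⟨f'⟩ ⟨g⟩
    exact Quot.sound (.add_comp f f' g _)
  comp_add := by
    rintro X Y Z ⟨f⟩ ⟨g⟩ ⟨g'⟩
    exact Quot.sound (.comp_add f g g' _)

instance : Linear ℚ (ShGraph n E i j) where
  homModule X Y := inferInstanceAs (Module ℚ (GHom n E X.graph Y.graph (Y.shift - X.shift)))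
  smul_comp := by
    rintro X Y Z q ⟨f⟩ ⟨g⟩
    exact Quot.sound (.smul_comp q f g _)
  comp_smul := by
    rintro X Y Z ⟨f⟩ q ⟨g⟩
    exact Quot.sound (.comp_smul q f g _)

/-- The morphism of shifted graphs given by an expression of the appropriate degree. -/
def ofArr (X Y : ShGraph n E i j) {d : ℤ} (f : Arr n X.graph Y.graph d)
    (h : d = Y.shift - X.shift) : X ⟶ Y :=
  GHom.cast h (GHom.mk E f)

theorem ofArr_comp {X Y Z : ShGraph n E i j} {d e k : ℤ} (f : Arr n X.graph Y.graph d)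
    (g : Arr n Y.graph Z.graph e) (hf) (hg) (h : d + e = k) :
    ofArr X Y f hf ≫ ofArr Y Z g hg = ofArr X Z (.comp f g h) (by omega) := by
  subst hf hg
  obtain rfl : k = Z.shift - X.shift := by omega
  rfl

theorem ofArr_eq {X Y : ShGraph n E i j} {d : ℤ} {f g : Arr n X.graph Y.graph d}
    (r : Rel n E f g) (h) : ofArr X Y f h = ofArr X Y g h := by
  subst h
  exact Quot.sound r

theorem ofArr_zero {X Y : ShGraph n E i j} {d : ℤ} (h : d = Y.shift - X.shift) :
    ofArr X Y .zero h = 0 := by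
  subst h
  rfl

end ShGraph

open ShGraph

/-- Formal direct sums of shifted graphs with source `i` and target `j`; a morphism is a matrix
of morphisms between shifted graphs. -/
abbrev FSum (n : ℕ) (E : Set Extra) (i j : Word) := Mat_ (ShGraph n E i j)

instance (n : ℕ) (E : Set Extra) (i j : Word) : HasBinaryBiproducts (FSum n E i j) :=
  hasBinaryBiproducts_of_finite_biproducts _

/-! ## Formal complexes and their equivalence -/

/-- Bounded formal complexes of formal direct sums of shifted graphs. -/
structure FComplex (n : ℕ) (E : Set Extra) (i j : Word) where
  cx : CochainComplex (FSum n E i j) ℤ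
  bounded : ∃ a b : ℤ, ∀ m, m < a ∨ b < m → IsZero (cx.X m)

section Equivalence

variable {V : Type*} [Category V] [Preadditive V] [HasBinaryBiproducts V]

/-- `P` consists of an invertible map from degree `m` to degree `m + 1` and is zero elsewhere;
up to isomorphism of complexes it is `N → N` with the identity as differential. -/
def IsDisk (P : CochainComplex V ℤ) (m : ℤ) : Prop :=
  IsIso (P.d m (m + 1)) ∧ ∀ l, l ≠ m → l ≠ m + 1 → IsZero (P.X l)

/-- `K` has the components `P_l ⊕ L_l`, with the differential given by the matrices
`(p α; 0 A)` where `p` and `A` are the differentials of `P` and `L`. -/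
def IsBlock (P L K : CochainComplex V ℤ) : Prop :=
  ∃ (e : ∀ l, K.X l ≅ P.X l ⊞ L.X l) (α : ∀ l, L.X l ⟶ P.X (l + 1)),
    ∀ l, K.d l (l + 1) = (e l).hom ≫
      Biprod.ofComponents (P.d l (l + 1)) 0 (α l) (L.d l (l + 1)) ≫ (e (l + 1)).inv

end Equivalence

/-- The elementary equivalences of formal complexes: isomorphic complexes are equivalent, and
terms `N → N` may be removed if they appear as a subcomplex or as a quotient complex. -/
inductive Step {n : ℕ} {E : Set Extra} {i j : Word} : FComplex n E i j → FComplex n E i j → Prop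
  | eq1 {K L : FComplex n E i j} (h : Nonempty (K.cx ≅ L.cx)) : Step K L
  | eq2 {K L : FComplex n E i j} (P : CochainComplex (FSum n E i j) ℤ) (m : ℤ)
      (hP : IsDisk P m) (h : IsBlock P L.cx K.cx) : Step K L
  | eq3 {K L : FComplex n E i j} (P : CochainComplex (FSum n E i j) ℤ) (m : ℤ)
      (hP : IsDisk P m) (h : IsBlock L.cx P K.cx) : Step K L

/-- Equivalence of formal complexes. -/
def Equivalent {n : ℕ} {E : Set Extra} {i j : Word} (K L : FComplex n E i j) : Prop :=
  Relation.EqvGen Step K L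

/-! ## Total complexes of two-row bicomplexes -/

section Total

variable {V : Type*} [Category V] [Preadditive V]

/-- The vertical component `K_a → L_b` of the total differential, for `b = a`: the vertical
arrow of column `a` with the sign `(-1)^a`. -/
noncomputable def vertComp {K L : CochainComplex V ℤ} (f : K ⟶ L) (a b : ℤ) : K.X a ⟶ L.X b :=
  if h : a = b then a.negOnePow • (f.f a ≫ (L.XIsoOfEq h).hom) else 0

theorem vertComp_comm {K L : CochainComplex V ℤ} (f : K ⟶ L) (a b c d : ℤ) (hb : a = b)
    (hc : a + 1 = c) (hd : a + 1 = d) :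
    vertComp f a b ≫ L.d b d + K.d a c ≫ vertComp f c d = 0 := by
  subst hb hc hd
  simp [vertComp, Int.negOnePow_succ, Units.smul_def]

variable [HasBinaryBiproducts V]

/-- The total complex of the bicomplex with top row `K` (in row `0`), bottom row `L` (in row `1`)
and vertical arrows `f`. -/
noncomputable def total {K L : CochainComplex V ℤ} (f : K ⟶ L) : CochainComplex V ℤ where
  X m := L.X (m - 1) ⊞ K.X m
  d a b := Biprod.ofComponents (L.d (a - 1) (b - 1)) 0 (vertComp f a (b - 1)) (K.d a b)
  shape a b h := by
    have h1 : ¬ (ComplexShape.up ℤ).Rel (a - 1) (b - 1) := by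
      intro h'; apply h; simp only [ComplexShape.up_Rel] at *; omega
    have h2 : ¬ a = b - 1 := by
      intro h'; apply h; simp only [ComplexShape.up_Rel] at *; omega
    rw [L.shape _ _ h1, K.shape _ _ h, vertComp, dif_neg h2]
    ext <;> simp
  d_comp_d' a b c hab hbc := by
    simp only [ComplexShape.up_Rel] at hab hbc
    have key := vertComp_comm f a (b - 1) b (c - 1) (by omega) hab (by omega)
    ext <;> simp [key]

end Total

/-! ## The complexes of the two-strand braids -/

/-- The boundary data `↑↑`. -/
abbrev uu : Word := [.up, .up]

section Rows

variable (n : ℕ) (E : Set Extra)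

/-- The terms `id₂, S{1}, S{3}, S{5}, …`. -/
def rowObj : ℕ → ShGraph n E uu uu
  | 0 => ⟨id2, ⟨trivial, trivial⟩, rfl, rfl, 0⟩
  | m + 1 => ⟨S₀, trivial, rfl, rfl, 2 * (m : ℤ) + 1⟩

/-- The terms `S{1}, S ∘ S{2}, S ∘ S{4}, S ∘ S{6}, …`. -/
def botObj : ℕ → ShGraph n E uu uu
  | 0 => ⟨S₀, trivial, rfl, rfl, 1⟩
  | m + 1 => ⟨SS, ⟨trivial, trivial, rfl⟩, rfl, rfl, 2 * (m : ℤ) + 2⟩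

/-- The alternating arrows `α, γ, α, γ, …`. -/
def altArr : ℕ → Arr n S₀ S₀ 2
  | 0 => .alpha
  | 1 => .gamma
  | m + 2 => altArr m

/-- The arrows `χ₀, α, γ, α, γ, …`. -/
def rowMap : (m : ℕ) → (rowObj n E m ⟶ rowObj n E (m + 1))
  | 0 => ofArr (rowObj n E 0) (rowObj n E 1) .chi0 (by simp [rowObj])
  | m + 1 => ofArr (rowObj n E (m + 1)) (rowObj n E (m + 2)) (altArr n m)
      (by simp [rowObj]; ring)

/-- The arrows `1 ∘ χ₀, 1 ∘ α, 1 ∘ γ, 1 ∘ α, …`. -/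
def botMap : (m : ℕ) → (botObj n E m ⟶ botObj n E (m + 1))
  | 0 => ofArr (botObj n E 0) (botObj n E 1) chiBot (by simp [botObj])
  | m + 1 => ofArr (botObj n E (m + 1)) (botObj n E (m + 2)) (whiskerTop S₀ (altArr n m))
      (by simp [botObj]; ring)

/-- The vertical arrows `χ₀ ∘ 1`. -/
def vertMap : (m : ℕ) → (rowObj n E m ⟶ botObj n E m)
  | 0 => ofArr (rowObj n E 0) (botObj n E 0) chiFirst (by simp [rowObj, botObj])
  | m + 1 => ofArr (rowObj n E (m + 1)) (botObj n E (m + 1)) chiTop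
      (by simp [rowObj, botObj])

variable {n E}

namespace GHom

/-- Vertical composition. -/
def vcomp {Γ Γ' Φ Φ' : Graph} {d e k : ℤ} (f : GHom n E Γ Γ' d) (g : GHom n E Φ Φ' e)
    (h : d + e = k) : GHom n E (.comp Γ Φ) (.comp Γ' Φ') k :=
  Quot.map₂ (fun f g => Arr.vcomp f g h) (fun f _ _ r => .vcomp h (.refl f) r)
    (fun _ _ g r => .vcomp h r (.refl g)) f g

end GHom

theorem mk_assoc {Γ Δ Θ Ξ : Graph} {a b c ab bc k : ℤ} (f : Arr n Γ Δ a)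
    (g : Arr n Δ Θ b) (l : Arr n Θ Ξ c) (h₁ : a + b = ab) (h₂ : ab + c = k)
    (h₃ : b + c = bc) (h₄ : a + bc = k) :
    GHom.mk E (.comp (.comp f g h₁) l h₂) = GHom.mk E (.comp f (.comp g l h₃) h₄) :=
  Quot.sound (.comp_assoc f g l _ _ _ _)

theorem mk_congr {Γ Δ Θ : Graph} {d e k : ℤ} {f f' : Arr n Γ Δ d} {g g' : Arr n Δ Θ e}
    (h : d + e = k) (hf : GHom.mk E f = GHom.mk E f') (hg : GHom.mk E g = GHom.mk E g') :
    GHom.mk E (.comp f g h) = GHom.mk E (.comp f' g' h) :=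
  congrArg₂ (fun x y => GHom.comp x y h) hf hg

theorem mk_vcongr {Γ Γ' Φ Φ' : Graph} {d e k : ℤ} {f f' : Arr n Γ Γ' d} {g g' : Arr n Φ Φ' e}
    (h : d + e = k) (hf : GHom.mk E f = GHom.mk E f') (hg : GHom.mk E g = GHom.mk E g') :
    GHom.mk E (.vcomp f g h) = GHom.mk E (.vcomp f' g' h) :=
  congrArg₂ (fun x y => GHom.vcomp x y h) hf hg

theorem mk_comp_zero {Γ Δ Θ : Graph} {d e k : ℤ} (f : Arr n Γ Δ d) (h : d + e = k) :
    GHom.mk E (.comp f (.zero : Arr n Δ Θ e) h) = GHom.mk E .zero := by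
  have h1 : GHom.mk E (.comp f (.zero : Arr n Δ Θ e) h)
      + GHom.mk E (.comp f (.zero : Arr n Δ Θ e) h)
      = GHom.mk E (.comp f (.zero : Arr n Δ Θ e) h) :=
    (Quot.sound (.comp_add f .zero .zero h)).symm.trans
      (mk_congr h rfl (Quot.sound (.zero_add .zero)))
  exact add_eq_left.mp h1

theorem mk_vcomp_zero {Γ Γ' Φ Φ' : Graph} {d e k : ℤ} (f : Arr n Γ Γ' d) (h : d + e = k) :
    GHom.mk E (.vcomp f (.zero : Arr n Φ Φ' e) h) = GHom.mk E .zero := by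
  have h1 : GHom.mk E (.vcomp f (.zero : Arr n Φ Φ' e) h)
      + GHom.mk E (.vcomp f (.zero : Arr n Φ Φ' e) h)
      = GHom.mk E (.vcomp f (.zero : Arr n Φ Φ' e) h) :=
    (Quot.sound (.vcomp_add f .zero .zero h)).symm.trans
      (mk_vcongr h rfl (Quot.sound (.zero_add .zero)))
  exact add_eq_left.mp h1

theorem mk_whiskerBot_whiskerTop {Γ Γ' Φ Φ' : Graph} {d e k : ℤ} (f : Arr n Γ Γ' d)
    (g : Arr n Φ Φ' e) (h : d + e = k) :
    GHom.mk E (.comp (whiskerBot f Φ) (whiskerTop Γ' g) h) = GHom.mk E (.vcomp f g h) :=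
  (Quot.sound (.vcomp_comp f (one _) (one _) g (add_zero d) (zero_add e) h _ _ _)).symm.trans
    (mk_vcongr h (Quot.sound (.comp_one f)) (Quot.sound (.one_comp g)))

theorem mk_whiskerTop_whiskerBot {Γ Γ' Φ Φ' : Graph} {d e k : ℤ} (f : Arr n Γ Γ' d)
    (g : Arr n Φ Φ' e) (h : d + e = k) (h' : e + d = k) :
    GHom.mk E (.comp (whiskerTop Γ g) (whiskerBot f Φ') h') = GHom.mk E (.vcomp f g h) :=
  (Quot.sound (.vcomp_comp (one _) f g (one _) (zero_add d) (add_zero e) h _ _ _)).symm.trans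
    (mk_vcongr h (Quot.sound (.one_comp f)) (Quot.sound (.comp_one g)))

theorem mk_whiskerTop_comp {Γ Φ Φ' Φ'' : Graph} {d e k : ℤ} (f : Arr n Φ Φ' d)
    (g : Arr n Φ' Φ'' e) (h : d + e = k) :
    GHom.mk E (.comp (whiskerTop Γ f) (whiskerTop Γ g) h)
      = GHom.mk E (whiskerTop Γ (.comp f g h)) :=
  (Quot.sound (.vcomp_comp (one _) (one _) f g (zero_add 0) h (zero_add k) _ _ _)).symm.trans
    (mk_vcongr _ (Quot.sound (.one_comp _)) rfl)

/-- `χ₀ ∘ 1` commutes with arrows applied below. -/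
theorem comp_insert_chi0 {Γ Δ : Graph} {d k : ℤ} (f : Arr n Γ Δ d) (hΓ : Γ.tgt = uu)
    (hΔ : Δ.tgt = uu) (h : d + 1 = k) (h' : 1 + d = k) :
    GHom.mk E (.comp f (.comp (.iu Δ uu hΔ) (whiskerBot .chi0 Δ) (zero_add 1)) h)
      = GHom.mk E (.comp (.iu Γ uu hΓ) (.vcomp .chi0 f h') (zero_add k)) := by
  refine (mk_assoc _ _ _ (add_zero d) h _ _).symm.trans ?_
  refine (mk_congr h (Quot.sound (.iu_naturality f uu hΓ hΔ)) rfl).trans ?_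
  refine (mk_assoc _ _ _ _ _ h (zero_add k)).trans ?_
  exact mk_congr _ rfl (mk_whiskerTop_whiskerBot .chi0 f h' h)

theorem insert_chi0_comp {Γ Δ : Graph} {d k : ℤ} (f : Arr n Γ Δ d) (hΓ : Γ.tgt = uu)
    (h' : 1 + d = k) :
    GHom.mk E (.comp (.comp (.iu Γ uu hΓ) (whiskerBot .chi0 Γ) (zero_add 1)) (whiskerTop S₀ f) h')
      = GHom.mk E (.comp (.iu Γ uu hΓ) (.vcomp .chi0 f h') (zero_add k)) := by
  refine (mk_assoc _ _ _ _ _ h' (zero_add k)).trans ?_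
  exact mk_congr _ rfl (mk_whiskerBot_whiskerTop .chi0 f h')

/-- The squares of the bicomplex away from the first column commute. -/
theorem comp_chiTop {d k : ℤ} (f : Arr n S₀ S₀ d) (h : d + 1 = k) (h' : 1 + d = k) :
    GHom.mk E (.comp f chiTop h) = GHom.mk E (.comp chiTop (whiskerTop S₀ f) h') :=
  (comp_insert_chi0 f rfl rfl h h').trans (insert_chi0_comp f rfl h').symm

/-- The first square of the bicomplex commutes. -/
theorem chi0_chiTop :
    GHom.mk E (.comp (.chi0 : Arr n _ _ _) chiTop one_add_one_eq_two)
      = GHom.mk E (.comp chiFirst chiBot one_add_one_eq_two) := by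
  refine (comp_insert_chi0 .chi0 rfl rfl _ one_add_one_eq_two).trans ?_
  refine (insert_chi0_comp .chi0 rfl one_add_one_eq_two).symm.trans ?_
  symm
  refine (mk_assoc _ _ _ _ _ (zero_add 1) one_add_one_eq_two).trans (mk_congr _ rfl ?_)
  refine (mk_assoc _ _ _ (zero_add 0) (zero_add 1) _ _).symm.trans ?_
  exact (mk_congr _ (Quot.sound (.idnInv_idn _ _ _)) rfl).trans (Quot.sound (.one_comp _))

theorem chi0_alpha {k : ℤ} (h : 1 + 2 = k) :
    GHom.mk E (.comp (.chi0 : Arr n _ _ _) .alpha h) = GHom.mk E .zero := by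
  refine (mk_congr h rfl (Quot.sound .moy2b_snd).symm).trans ?_
  refine (mk_assoc _ _ _ one_add_one_eq_two (by change (2 : ℤ) + 1 = k; omega) _ _).symm.trans ?_
  refine (mk_congr _ chi0_chiTop rfl).trans ?_
  refine (mk_assoc _ _ _ _ _ one_add_one_eq_two h).trans ?_
  exact (mk_congr _ rfl (Quot.sound .moy2a_snd)).trans (mk_comp_zero _ _)

theorem alpha_gamma {k : ℤ} (h : 2 + 2 = k) :
    GHom.mk E (.comp (.alpha : Arr n _ _ _) .gamma h) = GHom.mk E .zero := by
  refine (mk_congr h rfl (Quot.sound .moy2c_snd).symm).trans ?_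
  refine (mk_assoc _ _ _ (rfl : (2 : ℤ) + 1 = 3) (by change (3 : ℤ) + 1 = k; omega) _ _).symm.trans ?_
  refine (mk_congr _ (comp_chiTop .alpha _ rfl) rfl).trans ?_
  refine (mk_assoc _ _ _ _ _ (rfl : (2 : ℤ) + 1 = 3) (by omega)).trans ?_
  exact (mk_congr _ rfl (Quot.sound (.shift1_snd _))).trans (mk_comp_zero _ _)

theorem gamma_alpha {k : ℤ} (h : 2 + 2 = k) :
    GHom.mk E (.comp (.gamma : Arr n _ _ _) .alpha h) = GHom.mk E .zero := by
  refine (mk_congr h rfl (Quot.sound .moy2b_snd).symm).trans ?_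
  refine (mk_assoc _ _ _ (rfl : (2 : ℤ) + 1 = 3) (by change (3 : ℤ) + 1 = k; omega) _ _).symm.trans ?_
  refine (mk_congr _ (comp_chiTop .gamma _ rfl) rfl).trans ?_
  refine (mk_assoc _ _ _ _ _ (rfl : (2 : ℤ) + 1 = 3) (by omega)).trans ?_
  exact (mk_congr _ rfl (Quot.sound (.shift2_snd _))).trans (mk_comp_zero _ _)

theorem altArr_altArr {k : ℤ} (h : 2 + 2 = k) : ∀ m,
    GHom.mk E (.comp (altArr n m) (altArr n (m + 1)) h) = GHom.mk E .zero
  | 0 => alpha_gamma h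
  | 1 => gamma_alpha h
  | m + 2 => altArr_altArr h m

theorem ofArr_congr {i j : Word} {X Y : ShGraph n E i j} {d : ℤ} {f g : Arr n X.graph Y.graph d}
    (r : GHom.mk E f = GHom.mk E g) (h) : ofArr X Y f h = ofArr X Y g h := by
  simp only [ofArr, r]

theorem rowMap_rowMap : ∀ m, rowMap n E m ≫ rowMap n E (m + 1) = 0
  | 0 => (ofArr_comp _ _ _ _ rfl).trans ((ofArr_congr (chi0_alpha _) _).trans (ofArr_zero _))
  | m + 1 => (ofArr_comp _ _ _ _ rfl).trans
      ((ofArr_congr (altArr_altArr _ m) _).trans (ofArr_zero _))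

theorem botMap_botMap : ∀ m, botMap n E m ≫ botMap n E (m + 1) = 0
  | 0 => by
      refine (ofArr_comp _ _ _ _ (rfl : (1 : ℤ) + 2 = 3)).trans
        ((ofArr_congr ?_ _).trans (ofArr_zero _))
      refine (mk_assoc _ _ _ _ _ (rfl : (1 : ℤ) + 2 = 3) (zero_add 3)).trans ?_
      refine (mk_congr _ rfl ?_).trans (mk_comp_zero _ _)
      refine (mk_whiskerTop_comp _ _ _).trans ?_
      exact (mk_vcongr _ rfl (chi0_alpha _)).trans (mk_vcomp_zero _ _)
  | m + 1 => by
      refine (ofArr_comp _ _ _ _ rfl).trans ((ofArr_congr ?_ _).trans (ofArr_zero _))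
      refine (mk_whiskerTop_comp _ _ _).trans ?_
      exact (mk_vcongr _ rfl (altArr_altArr _ m)).trans (mk_vcomp_zero _ _)

theorem rowMap_vertMap : ∀ m, rowMap n E m ≫ vertMap n E (m + 1) = vertMap n E m ≫ botMap n E m
  | 0 => (ofArr_comp _ _ _ _ one_add_one_eq_two).trans
      ((ofArr_congr chi0_chiTop _).trans (ofArr_comp _ _ _ _ one_add_one_eq_two).symm)
  | _ + 1 => (ofArr_comp _ _ _ _ rfl).trans
      ((ofArr_congr (comp_chiTop _ _ rfl) _).trans (ofArr_comp _ _ _ _ (rfl : (1 : ℤ) + 2 = 2 + 1)).symm)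

end Rows

section Truncation

variable {C : Type*} [Category C] [Preadditive C]

/-- The terms of the complex `X 0 → X 1 → ⋯ → X N` of one-term formal sums: the index set of the
formal sum in degree `m` has one element for `0 ≤ m ≤ N` and is empty otherwise. -/
noncomputable def seqObj (N : ℕ) (X : ℕ → C) : ℤ → Mat_ C
  | .ofNat m => { ι := PLift (m ≤ N), X := fun _ => X m }
  | .negSucc _ => { ι := Empty, X := fun a => a.elim }

/-- The differential of the complex `X 0 → X 1 → ⋯ → X N`. -/
noncomputable def seqMap (N : ℕ) (X : ℕ → C) (d : ∀ m, X m ⟶ X (m + 1)) :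
    ∀ m : ℤ, seqObj N X m ⟶ seqObj N X (m + 1)
  | .ofNat m => fun (_ : PLift (m ≤ N)) (_ : PLift (m + 1 ≤ N)) => d m
  | .negSucc _ => fun (a : Empty) => a.elim

/-- The complex `X 0 → X 1 → ⋯ → X N`, with `X 0` in degree `0`. -/
noncomputable def seqComplex (N : ℕ) (X : ℕ → C) (d : ∀ m, X m ⟶ X (m + 1))
    (hd : ∀ m, d m ≫ d (m + 1) = 0) : CochainComplex (Mat_ C) ℤ :=
  CochainComplex.of (seqObj N X) (seqMap N X d) (by
    rintro (m | m)
    · ext a b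
      refine Finset.sum_eq_zero fun c _ => hd m
    · ext a b
      exact Empty.elim a)

theorem seqObj_isZero (N : ℕ) (X : ℕ → C) (m : ℤ) (hm : m < 0 ∨ (N : ℤ) < m) :
    IsZero (seqObj N X m) := by
  rw [IsZero.iff_id_eq_zero]
  rcases m with m | m
  · ext a b
    have h1 : m ≤ N := a.down
    have h2 : (Int.ofNat m) = (m : ℤ) := rfl
    omega
  · ext a b
    exact Empty.elim a

/-- The components of a morphism of complexes. -/
noncomputable def seqHomF (N : ℕ) {X Y : ℕ → C} (f : ∀ m, X m ⟶ Y m) :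
    ∀ m : ℤ, seqObj N X m ⟶ seqObj N Y m
  | .ofNat m => fun (_ _ : PLift (m ≤ N)) => f m
  | .negSucc _ => fun (a : Empty) => a.elim

/-- The morphism of complexes given by the commuting squares on `X m → Y m`. -/
noncomputable def seqHom (N : ℕ) {X Y : ℕ → C} {d : ∀ m, X m ⟶ X (m + 1)}
    {d' : ∀ m, Y m ⟶ Y (m + 1)}
    (hd : ∀ m, d m ≫ d (m + 1) = 0) (hd' : ∀ m, d' m ≫ d' (m + 1) = 0)
    (f : ∀ m, X m ⟶ Y m) (hf : ∀ m, d m ≫ f (m + 1) = f m ≫ d' m) :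
    seqComplex N X d hd ⟶ seqComplex N Y d' hd' :=
  CochainComplex.ofHom (X := seqComplex N X d hd) (Y := seqComplex N Y d' hd') (seqHomF N f) (by
    intro i
    change seqHomF N f i ≫ CochainComplex.of.d _ (seqMap N Y d') i (i + 1)
      = CochainComplex.of.d _ (seqMap N X d) i (i + 1) ≫ seqHomF N f (i + 1)
    rw [CochainComplex.of_d, CochainComplex.of_d]
    rcases i with m | m
    · ext (a : PLift (m ≤ N)) (b : PLift (m + 1 ≤ N))
      exact (Fintype.sum_subsingleton (fun c : PLift (m ≤ N) => f m ≫ d' m) a).trans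
        ((hf m).symm.trans
          (Fintype.sum_subsingleton (fun c : PLift (m + 1 ≤ N) => d m ≫ f (m + 1)) b).symm)
    · ext a b
      exact Empty.elim a)

end Truncation

theorem total_isZero {V : Type*} [Category V] [Preadditive V] [HasBinaryBiproducts V]
    {K L : CochainComplex V ℤ} (f : K ⟶ L) (m : ℤ) (hK : IsZero (K.X m))
    (hL : IsZero (L.X (m - 1))) : IsZero ((total f).X m) := by
  rw [IsZero.iff_id_eq_zero]
  apply biprod.hom_ext'
  · exact hL.eq_of_src _ _
  · exact hK.eq_of_src _ _

section Main

variable (n : ℕ) (E : Set Extra) (N : ℕ)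

/-- The formal complex `id₂ → S{1} → S{3} → S{5} → ⋯ → S{2N-1}` with the differentials
`χ₀, α, γ, α, …`, where `id₂` is in degree `0`. -/
noncomputable def rowComplex : FComplex n E uu uu where
  cx := seqComplex N (rowObj n E) (rowMap n E) rowMap_rowMap
  bounded := ⟨0, N, seqObj_isZero N _⟩

/-- The formal complex `S{1} → S ∘ S{2} → S ∘ S{4} → ⋯ → S ∘ S{2N}` with the differentials
`1 ∘ χ₀, 1 ∘ α, 1 ∘ γ, 1 ∘ α, …`, where `S{1}` is in degree `0`. -/
noncomputable def botComplex : FComplex n E uu uu where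
  cx := seqComplex N (botObj n E) (botMap n E) botMap_botMap
  bounded := ⟨0, N, seqObj_isZero N _⟩

/-- The bicomplex with top row `rowComplex`, bottom row `botComplex` and the vertical arrows
`χ₀ ∘ 1`. -/
noncomputable def bicomplex : (rowComplex n E N).cx ⟶ (botComplex n E N).cx :=
  seqHom N rowMap_rowMap botMap_botMap (vertMap n E) rowMap_vertMap

/-- The total complex of this bicomplex. -/
noncomputable def totalComplex : FComplex n E uu uu where
  cx := total (bicomplex n E N)
  bounded := ⟨0, N + 1, fun m hm =>
    total_isZero _ m (seqObj_isZero N _ m (by omega)) (seqObj_isZero N _ (m - 1) (by omega))⟩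

end Main

end MOY

/-! Write `X 0 = id₂`, `X m = S{2m-1}` for the terms of the top row and `Y m` for those of the
bottom row, in columns `0, …, N`. Here `Y 0 = X 1`, and for `m ≥ 1` the arrow `φ` (odd `m`) or `ψ`
(even `m`) splits `Y m = S ∘ S{2m}` as `X m ⊕ X (m + 1)`. In these coordinates the relations for `φ
(1 ∘ χ₀)`, `ψ (1 ∘ α)` and `φ (1 ∘ γ)` say that each bottom differential kills the first summand of
`Y m` and carries the second identically onto the first summand of `Y (m + 1)`. Hence the bottom row
is the direct sum of the two-term complexes `X m → X m` with `1 ≤ m ≤ N` and of the single term `X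
(N + 1)` in column `N` (`seqComplexIso`).

The bottom row is a subcomplex of the total complex, and so is each of its direct summands. The
two-term complexes can therefore be removed one by one, without any correction to the remaining
differential (`equivalent_of_pairs`). What is left is the top row together with `X (N + 1)` in total
degree `N + 1`. The arrow into this last term is the second component of `χ₀ ∘ 1 : X N → Y N`, which
by the relations for `φ (χ₀ ∘ 1)` and `ψ (χ₀ ∘ 1)` is `α` or `γ`, namely the next differential of
the top row. It carries the sign `(-1)^N`, absorbed by rescaling the last term
(`seqComplexSuccIso`).

The argument up to this point is formal and is collected in `equivalent_total_seqHom`; the relations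
enter through `botMap_fstMap`, `botMap_sndMap` and `vertMap_sndMap`. All of them are always imposed,
so `E` plays no role. -/

namespace MOY

open MOY.Graph MOY.Arr ShGraph

/-! ### Direct summands of the bottom row as subcomplexes of the total complex -/

section Splitting

variable {V : Type*} [Category V] [Preadditive V]

theorem vertComp_naturality {K L L' : CochainComplex V ℤ} (f : K ⟶ L) (g : L ⟶ L') (a b : ℤ) :
    vertComp f a b ≫ g.f b = vertComp (f ≫ g) a b := by
  unfold vertComp
  split_ifs with h
  · subst h; simp
  · simp

/-- A complex moved by one degree, with the same differential. -/
def delay (P : CochainComplex V ℤ) : CochainComplex V ℤ where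
  X m := P.X (m - 1)
  d a b := P.d (a - 1) (b - 1)
  shape a b h := P.shape _ _ fun h' => h (by simp only [ComplexShape.up_Rel] at *; omega)
  d_comp_d' _ _ _ _ _ := P.d_comp_d _ _ _

theorem isDisk_delay {P : CochainComplex V ℤ} {m : ℤ} (h : IsDisk P m) :
    IsDisk (delay P) (m + 1) := by
  refine ⟨?_, fun l hl hl' => h.2 _ (by omega) (by omega)⟩
  -- The indices `m + 1 - 1` and `m + 1 + 1 - 1` equal `m` and `m + 1` only propositionally, so the
  -- claim is generalized before substituting.
  have key : ∀ a b : ℤ, a = m → b = m + 1 → IsIso (P.d a b) := by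
    rintro _ _ rfl rfl; exact h.1
  exact key _ _ (by omega) (by omega)

variable [HasBinaryBiproducts V]

/-- An isomorphism with a biproduct from a chain map that is a degreewise isomorphism. -/
noncomputable def isoBiprodOfLift {L P Q : CochainComplex V ℤ} (u : L ⟶ P) (v : L ⟶ Q)
    (h : ∀ l, IsIso (biprod.lift (u.f l) (v.f l))) : L ≅ P ⊞ Q :=
  haveI : ∀ l, IsIso ((biprod.lift u v).f l) := fun l => by
    -- The degree `l` term of a biproduct of complexes is only canonically isomorphic to the
    -- biproduct of the terms; `biprodXIso` mediates.
    have e : (biprod.lift u v).f l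
        = biprod.lift (u.f l) (v.f l) ≫ (HomologicalComplex.biprodXIso P Q l).inv := by
      rw [Iso.eq_comp_inv]
      ext <;> simp [← HomologicalComplex.comp_f]
    rw [e]
    have := h l
    infer_instance
  haveI := HomologicalComplex.Hom.isIso_of_components (biprod.lift u v)
  asIso (biprod.lift u v)

/-- Matrix form of the compatibility needed in `totalIso`: changing the bottom row affects the
vertical entry only by composition, so one commuting square suffices. -/
theorem map_ofComponents {A A' B B' K K' : V} (u : A ⟶ B) (u' : A' ⟶ B') (a : A ⟶ A')
    (b : B ⟶ B') (v : K ⟶ A') (k : K ⟶ K') (h : u ≫ b = a ≫ u') :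
    biprod.map u (𝟙 K) ≫ Biprod.ofComponents b 0 (v ≫ u') k
      = Biprod.ofComponents a 0 v k ≫ biprod.map u' (𝟙 K') := by
  ext <;> simp [Biprod.ofComponents, h]

/-- The total complex depends on the bottom row only up to isomorphism. -/
noncomputable def totalIso {K L L' : CochainComplex V ℤ} (f : K ⟶ L) (e : L ≅ L') :
    total f ≅ total (f ≫ e.hom) :=
  HomologicalComplex.Hom.isoOfComponents
    (fun l => biprod.mapIso ((HomologicalComplex.eval _ _ (l - 1)).mapIso e) (Iso.refl _))
    (fun a b _ => by
      refine Eq.trans ?_ (map_ofComponents (e.hom.f (a - 1)) (e.hom.f (b - 1)) (L.d _ _)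
        (L'.d _ _) (vertComp f a (b - 1)) (K.d a b) (e.hom.comm _ _))
      rw [vertComp_naturality]
      rfl)

/-- The isomorphism `M ⊞ K ≅ P ⊞ L ⊞ K` given by a decomposition of `M`. -/
noncomputable def splitIso {M P L : V} (i : P ⟶ M) (j : L ⟶ M) (p : M ⟶ P) (q : M ⟶ L)
    (h : p ≫ i + q ≫ j = 𝟙 M) (ip : i ≫ p = 𝟙 P) (jq : j ≫ q = 𝟙 L) (iq : i ≫ q = 0)
    (jp : j ≫ p = 0) (K : V) : M ⊞ K ≅ P ⊞ L ⊞ K where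
  hom := biprod.desc (biprod.lift p (q ≫ biprod.inl)) (biprod.inr ≫ biprod.inr)
  inv := biprod.desc (i ≫ biprod.inl) (biprod.desc (j ≫ biprod.inl) biprod.inr)
  hom_inv_id := by
    apply biprod.hom_ext'
    · have h' := congrArg (· ≫ (biprod.inl : M ⟶ M ⊞ K)) h
      simpa using h'
    · simp
  inv_hom_id := by ext <;> simp [ip, jq, iq, jp]

/-- By `hp` and `hq` the map `m` is diagonal for the two decompositions. After reassociation nothing
leaves `P` except `a`, and the only other entry into `P'` is `v ≫ p'`, coming from `K`. This is the
block triangular shape required by `IsBlock`. -/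
theorem ofComponents_eq_splitIso {M P L M' P' L' K K' : V} {i : P ⟶ M} {j : L ⟶ M} {p : M ⟶ P}
    {q : M ⟶ L} (h : p ≫ i + q ≫ j = 𝟙 M) (ip : i ≫ p = 𝟙 P) (jq : j ≫ q = 𝟙 L)
    (iq : i ≫ q = 0) (jp : j ≫ p = 0) {i' : P' ⟶ M'} {j' : L' ⟶ M'} {p' : M' ⟶ P'}
    {q' : M' ⟶ L'} (h' : p' ≫ i' + q' ≫ j' = 𝟙 M') (ip' : i' ≫ p' = 𝟙 P')
    (jq' : j' ≫ q' = 𝟙 L') (iq' : i' ≫ q' = 0) (jp' : j' ≫ p' = 0)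
    (m : M ⟶ M') (a : P ⟶ P') (b : L ⟶ L') (v : K ⟶ M') (k : K ⟶ K')
    (hp : m ≫ p' = p ≫ a) (hq : m ≫ q' = q ≫ b) :
    Biprod.ofComponents m 0 v k = (splitIso i j p q h ip jq iq jp K).hom ≫
      Biprod.ofComponents a 0 (biprod.desc 0 (v ≫ p')) (Biprod.ofComponents b 0 (v ≫ q') k) ≫
      (splitIso i' j' p' q' h' ip' jq' iq' jp' K').inv := by
  rw [← Category.assoc, Iso.eq_comp_inv]
  ext <;> simp [Biprod.ofComponents, splitIso, hp, hq]

/-- A summand of the bottom row is a subcomplex of the total complex. -/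
theorem isBlock_total {K P L : CochainComplex V ℤ} (f : K ⟶ P ⊞ L) :
    IsBlock (delay P) (total (f ≫ biprod.snd)) (total f) := by
  -- The degreewise components of the inclusions and projections satisfy the biproduct identities,
  -- which is all that `splitIso` asks for.
  have h (l : ℤ) := HomologicalComplex.biprod_total_f P L l
  have ip (l : ℤ) := HomologicalComplex.biprod_inl_fst_f P L l
  have jq (l : ℤ) := HomologicalComplex.biprod_inr_snd_f P L l
  have iq (l : ℤ) := HomologicalComplex.biprod_inl_snd_f P L l
  have jp (l : ℤ) := HomologicalComplex.biprod_inr_fst_f P L l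
  refine ⟨fun l => splitIso _ _ _ _ (h (l - 1)) (ip _) (jq _) (iq _) (jp _) (K.X l),
    -- The off-diagonal block is zero on `L`, because the bottom row is a direct sum, and is the
    -- `P`-component of the vertical arrow on `K`.
    fun l => biprod.desc 0 (vertComp f l (l + 1 - 1) ≫ (biprod.fst : P ⊞ L ⟶ P).f (l + 1 - 1)),
    fun l => ?_⟩
  refine (ofComponents_eq_splitIso (h _) (ip _) (jq _) (iq _) (jp _) (h _) (ip _) (jq _) (iq _)
    (jp _) ((P ⊞ L).d (l - 1) (l + 1 - 1)) (P.d _ _) (L.d _ _) (vertComp f l (l + 1 - 1))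
    (K.d l (l + 1)) (by simp) (by simp)).trans ?_
  rw [vertComp_naturality f biprod.snd]
  rfl

/-- `L.X m` is a retract of `K.X m`. This keeps the intermediate complexes bounded. -/
theorem IsBlock.isZero {P L K : CochainComplex V ℤ} (h : IsBlock P L K) {m : ℤ}
    (hK : IsZero (K.X m)) : IsZero (L.X m) := by
  obtain ⟨e, -, -⟩ := h
  rw [IsZero.iff_id_eq_zero]
  calc 𝟙 _ = (biprod.inr ≫ (e m).inv) ≫ (e m).hom ≫ biprod.snd := by simp
    _ = 0 := by rw [hK.eq_of_src ((e m).hom ≫ biprod.snd) 0, comp_zero]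

end Splitting

/-! ### Contractible complexes built from identities -/

section Pairs

variable {V : Type*} [Category V] [Preadditive V] [HasBinaryBiproducts V]

/-- The complex with terms `A m ⊞ A (m + 1)` whose differential identifies the second summand
with the first summand of the next term. -/
noncomputable def pairs (A : ℤ → V) : CochainComplex V ℤ :=
  CochainComplex.of (fun m => A m ⊞ A (m + 1)) (fun _ => biprod.snd ≫ biprod.inl) (by simp)

theorem pairs_d (A : ℤ → V) (m : ℤ) :
    (pairs A).d m (m + 1) = (biprod.snd ≫ biprod.inl : A m ⊞ A (m + 1) ⟶ _) :=
  CochainComplex.of_d (fun m => A m ⊞ A (m + 1)) (fun _ => biprod.snd ≫ biprod.inl) m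

/-- A morphism of complexes to `pairs A`. -/
noncomputable def toPairs {A : ℤ → V} {L : CochainComplex V ℤ} (u : ∀ m, L.X m ⟶ A m)
    (v : ∀ m, L.X m ⟶ A (m + 1)) (h : ∀ m, L.d m (m + 1) ≫ u (m + 1) = v m)
    (h' : ∀ m, L.d m (m + 1) ≫ v (m + 1) = 0) : L ⟶ pairs A :=
  CochainComplex.ofHom (Y := pairs A) (fun m => biprod.lift (u m) (v m)) fun m => by
    rw [pairs_d]
    change biprod.lift (u m) (v m) ≫ biprod.snd ≫ biprod.inl
      = L.d m (m + 1) ≫ biprod.lift (u (m + 1)) (v (m + 1))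
    apply biprod.hom_ext <;> simp [h, h']

theorem snd_inl_map {A A' A'' B B' B'' : V} (e : A ⟶ B) (e' : A' ⟶ B') (e'' : A'' ⟶ B'') :
    biprod.map e e' ≫ biprod.snd ≫ (biprod.inl : B' ⟶ B' ⊞ B'')
      = (biprod.snd ≫ biprod.inl) ≫ biprod.map e' e'' := by
  simp

/-- After the identifications `e` and `e'` this is the interchange of the two middle summands in `(B
⊞ C) ⊞ (B' ⊞ C')`; the inverse is the opposite interchange. -/
theorem isIso_lift_map {A A' B B' C C' : V} (e : A ≅ B ⊞ C) (e' : A' ≅ B' ⊞ C') :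
    IsIso (biprod.lift (biprod.map (e.hom ≫ biprod.fst) (e'.hom ≫ biprod.fst))
      (biprod.map (e.hom ≫ biprod.snd) (e'.hom ≫ biprod.snd))) := by
  refine ⟨biprod.desc (biprod.map (biprod.inl ≫ e.inv) (biprod.inl ≫ e'.inv))
    (biprod.map (biprod.inr ≫ e.inv) (biprod.inr ≫ e'.inv)), ?_, ?_⟩
  · have h : ∀ {X Y Z : V} (e : X ≅ Y ⊞ Z), e.hom ≫ biprod.fst ≫ biprod.inl ≫ e.inv
        + e.hom ≫ biprod.snd ≫ biprod.inr ≫ e.inv = 𝟙 _ := fun e => by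
      rw [← Preadditive.comp_add, ← Category.assoc biprod.fst, ← Category.assoc biprod.snd,
        ← Preadditive.add_comp, biprod.total]
      simp
    ext <;> simp [h]
  · ext <;> simp

/-- The map of `pairs` induced by a family of maps. -/
noncomputable def pairsMap {A B : ℤ → V} (e : ∀ m, A m ⟶ B m) : pairs A ⟶ pairs B :=
  CochainComplex.ofHom (X := pairs A) (Y := pairs B)
    (fun m => biprod.map (e m) (e (m + 1))) fun m => by
    rw [pairs_d, pairs_d]
    exact snd_inl_map _ _ _

/-- `pairs` is additive. -/
noncomputable def pairsIso {A B C : ℤ → V} (e : ∀ m, A m ≅ B m ⊞ C m) :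
    pairs A ≅ pairs B ⊞ pairs C :=
  isoBiprodOfLift (pairsMap fun m => (e m).hom ≫ biprod.fst)
    (pairsMap fun m => (e m).hom ≫ biprod.snd)
    (fun m => isIso_lift_map (e m) (e (m + 1)))

theorem pairs_isZero {A : ℤ → V} {m : ℤ} (h : IsZero (A m)) (h' : IsZero (A (m + 1))) :
    IsZero ((pairs A).X m) := by
  change IsZero (A m ⊞ A (m + 1))
  rw [IsZero.iff_id_eq_zero]
  exact biprod.hom_ext' _ _ (h.eq_of_src _ _) (h'.eq_of_src _ _)

/-- Both biproducts reduce to `B`, and the map becomes the identity of `B`. -/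
theorem isIso_snd_inl {A B C : V} (hA : IsZero A) (hC : IsZero C) :
    IsIso (biprod.snd ≫ biprod.inl : A ⊞ B ⟶ B ⊞ C) := by
  refine ⟨biprod.fst ≫ biprod.inr, ?_, ?_⟩
  · apply biprod.hom_ext'
    · exact hA.eq_of_src _ _
    · simp
  · apply biprod.hom_ext'
    · simp
    · exact hC.eq_of_src _ _

/-- If `A` is concentrated in degree `m`, then `pairs A` is `A m → A m` up to isomorphism. -/
theorem isDisk_pairs {A : ℤ → V} {m : ℤ} (h : ∀ l, l ≠ m + 1 → IsZero (A l)) :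
    IsDisk (pairs A) m := by
  refine ⟨?_, fun l hl hl' => pairs_isZero (h _ (by omega)) (h _ (by omega))⟩
  rw [pairs_d]
  -- The object `A (m + 1)` occurs as second summand in degree `m` and as first summand in degree `m
  -- + 1`. The disk thus starts one degree below the degree in which `A` lives.
  exact isIso_snd_inl (h m (by omega)) (h _ (by omega))

/-- Isolates one degree of `A`: `D` gives rise to a single disk, and `B` has smaller support, which
drives the induction in `equivalent_of_pairs`. -/
theorem exists_splitting [HasZeroObject V] (A : ℤ → V) (m : ℤ) :
    ∃ D B : ℤ → V, (∀ l, Nonempty (A l ≅ D l ⊞ B l)) ∧ (∀ l, l ≠ m → IsZero (D l)) ∧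
      IsZero (B m) ∧ ∀ l, IsZero (A l) → IsZero (B l) := by
  classical
  obtain ⟨Z, hZ⟩ := HasZeroObject.zero (C := V)
  refine ⟨fun l => if l = m then A l else Z, fun l => if l = m then Z else A l,
    fun l => ?_, fun l hl => ?_, ?_, fun l hl => ?_⟩
  · dsimp only
    split_ifs with h
    · refine ⟨⟨biprod.inl, biprod.fst, by simp, ?_⟩⟩
      apply biprod.hom_ext'
      · simp
      · exact hZ.eq_of_src _ _
    · refine ⟨⟨biprod.inr, biprod.snd, by simp, ?_⟩⟩
      apply biprod.hom_ext'
      · exact hZ.eq_of_src _ _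
      · simp
  · simpa only [if_neg hl] using hZ
  · simpa only [if_true] using hZ
  · dsimp only
    split_ifs with h
    · exact hZ
    · exact hl

end Pairs

/-! ### Removing the contractible part disk by disk -/

section Peel

variable {n : ℕ} {E : Set Extra} {i j : Word}

/-- Summands `pairs A` of the bottom row may be removed. -/
theorem equivalent_of_pairs (a : ℤ) (k : ℕ) : ∀ (A : ℤ → FSum n E i j)
    (_ : ∀ m, m < a ∨ a + k ≤ m → IsZero (A m)) {K L : CochainComplex (FSum n E i j) ℤ}
    (f : K ⟶ pairs A ⊞ L) (hf : ∃ a b : ℤ, ∀ m, m < a ∨ b < m → IsZero ((total f).X m))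
    (hf' : ∃ a b : ℤ, ∀ m, m < a ∨ b < m → IsZero ((total (f ≫ biprod.snd)).X m)),
    Equivalent ⟨total f, hf⟩ ⟨total (f ≫ biprod.snd), hf'⟩ := by
  induction k with
  | zero =>
    intro A hA K L f hf hf'
    -- Here `A` vanishes in every degree, so `pairs A` is a zero disk at any position; the degree
    -- `0` is an arbitrary choice.
    exact .rel _ _ (.eq2 (delay (pairs A)) (0 + 1)
      (isDisk_delay (isDisk_pairs fun l _ => hA l (by omega))) (isBlock_total f))
  | succ k ih =>
    intro A hA K L f hf hf'
    -- The support of `A` lies in the interval from `a` to `a + k`. Its top degree `a + k` is split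
    -- off, and `B` falls under the induction hypothesis.
    obtain ⟨D, B, ⟨e⟩, hD, hB, hAB⟩ : ∃ D B : ℤ → FSum n E i j,
        Nonempty (∀ l, A l ≅ D l ⊞ B l) ∧ (∀ l, l ≠ a + k → IsZero (D l)) ∧
        IsZero (B (a + k)) ∧ ∀ l, IsZero (A l) → IsZero (B l) := by
      obtain ⟨D, B, e, h⟩ := exists_splitting A (a + k)
      exact ⟨D, B, ⟨fun l => (e l).some⟩, h⟩
    have : HasBinaryBiproducts (CochainComplex (FSum n E i j) ℤ) := ⟨fun _ _ => inferInstance⟩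
    let u : pairs A ⊞ L ≅ pairs D ⊞ pairs B ⊞ L :=
      biprod.mapIso (pairsIso e) (Iso.refl L) ≪≫ biprod.associator _ _ _
    -- Discarding `pairs D` and then `pairs B` leaves the same vertical map as discarding `pairs A`
    -- at once.
    have hu : (f ≫ u.hom) ≫ biprod.snd ≫ biprod.snd = f ≫ biprod.snd := by simp [u]
    obtain ⟨c, d, hcd⟩ := hf
    have h₁ : ∀ m, m < c ∨ d < m → IsZero ((total (f ≫ u.hom)).X m) := fun m hm =>
      (hcd m hm).of_iso ((HomologicalComplex.eval _ _ m).mapIso (totalIso f u)).symm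
    have hb := isBlock_total (f ≫ u.hom)
    have h₂ : ∀ m, m < c ∨ d < m → IsZero ((total ((f ≫ u.hom) ≫ biprod.snd)).X m) :=
      fun m hm => hb.isZero (h₁ m hm)
    have e₁ : Equivalent (n := n) ⟨total f, c, d, hcd⟩ ⟨total (f ≫ u.hom), c, d, h₁⟩ :=
      .rel _ _ (.eq1 ⟨totalIso f u⟩)
    have e₂ : Equivalent (n := n) ⟨total (f ≫ u.hom), c, d, h₁⟩
        ⟨total ((f ≫ u.hom) ≫ biprod.snd), c, d, h₂⟩ :=
      -- `D` lives in degree `a + k`, so `pairs D` is a disk at `a + k - 1`; placing it in the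
      -- second row of the total complex adds one.
      .rel _ _ (.eq2 (delay (pairs D)) (a + k - 1 + 1)
        (isDisk_delay (isDisk_pairs fun l hl => hD l (by omega))) hb)
    have hB' : ∀ m, m < a ∨ a + k ≤ m → IsZero (B m) := fun m hm => by
      by_cases h : m = a + k
      · exact h ▸ hB
      · exact hAB m (hA m (by push_cast; omega))
    have e₃ := ih B hB' ((f ≫ u.hom) ≫ biprod.snd) ⟨c, d, h₂⟩
      (by simpa only [Category.assoc, ← hu] using hf')
    simp only [Category.assoc] at e₁ e₂ e₃ hu
    simp only [hu] at e₃
    exact e₁.trans _ _ _ (e₂.trans _ _ _ e₃)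

end Peel

/-! ### Bottom rows with zero differential, and the sign of the vertical arrows -/

section Concentrated

variable {V : Type*} [Category V] [Preadditive V]

/-- The complex with the term `T (m + 1)` in degree `m` and zero differentials. -/
noncomputable def conc (T : ℤ → V) : CochainComplex V ℤ :=
  CochainComplex.of (fun m => T (m + 1)) (fun _ => 0) (by simp)

theorem conc_d (T : ℤ → V) (a b : ℤ) : (conc T).d a b = 0 := by
  by_cases h : a + 1 = b
  · subst h
    exact CochainComplex.of_d (fun m => T (m + 1)) (fun _ => 0) a
  · exact (conc T).shape a b h

/-- A morphism of complexes to `conc T`. -/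
noncomputable def toConc {T : ℤ → V} {K : CochainComplex V ℤ} (t : ∀ m, K.X m ⟶ T (m + 1))
    (h : ∀ m, K.d m (m + 1) ≫ t (m + 1) = 0) : K ⟶ conc T :=
  CochainComplex.ofHom (Y := conc T) t fun m => by
    rw [conc_d]
    exact comp_zero.trans (h m).symm

/-- The total differential uses `b = l + 1 - 1`, which is `l` only propositionally; `eqToHom`
records the resulting transport. -/
theorem vertComp_toConc {T : ℤ → V} {K : CochainComplex V ℤ} (t : ∀ m, K.X m ⟶ T (m + 1))
    (h : ∀ m, K.d m (m + 1) ≫ t (m + 1) = 0) (l b : ℤ) (hb : l = b) :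
    vertComp (toConc t h) l b
      = l.negOnePow • (t l ≫ eqToHom (by rw [hb]) : K.X l ⟶ T (b + 1)) := by
  subst hb
  simp only [vertComp, dif_pos, HomologicalComplex.XIsoOfEq_rfl, Iso.refl_hom, eqToHom_refl]
  rfl

/-- An equality of objects with a sign, as an isomorphism. -/
@[simps]
noncomputable def signIso (l : ℤ) {A B : V} (h : A = B) : A ≅ B where
  hom := l.negOnePow • eqToHom h
  inv := l.negOnePow • eqToHom h.symm
  hom_inv_id := by
    subst h
    rcases Int.even_or_odd l with h | h <;>
      simp [Int.negOnePow_even, Int.negOnePow_odd, h]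
  inv_hom_id := by
    subst h
    rcases Int.even_or_odd l with h | h <;>
      simp [Int.negOnePow_even, Int.negOnePow_odd, h]

variable [HasBinaryBiproducts V]

/-- The vertical arrow has the sign `(-1)^l` in the total complex and none in the single row it is
compared with. Rescaling the bottom summand in total degree `l` by `(-1)^(l+1)` puts `(-1)^(l+2) =
(-1)^l` on its target. Nothing leaves the bottom summands, so no other entry constrains the
rescaling. -/
theorem ofComponents_sign {A A' B B' K K' : V} (l : ℤ) (a : A = A') (b : B = B') (t : K ⟶ B)
    (k : K ⟶ K') :
    Biprod.ofComponents 0 0 t k ≫ biprod.map (signIso (l + 1 + 1) b).hom (𝟙 K')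
      = biprod.map (signIso (l + 1) a).hom (𝟙 K) ≫
        Biprod.ofComponents 0 0 (l.negOnePow • (t ≫ eqToHom b)) k := by
  subst a b
  ext <;> simp [Biprod.ofComponents, Int.negOnePow_succ, Units.smul_def]

/-- The total complex of a bicomplex whose bottom row has zero differentials. -/
noncomputable def totalConcIso {T : ℤ → V} {K M : CochainComplex V ℤ}
    (t : ∀ m, K.X m ⟶ T (m + 1)) (h : ∀ m, K.d m (m + 1) ≫ t (m + 1) = 0)
    (e : ∀ l, M.X l ≅ T l ⊞ K.X l)
    (he : ∀ l, M.d l (l + 1) ≫ (e (l + 1)).hom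
      = (e l).hom ≫ Biprod.ofComponents 0 0 (t l) (K.d l (l + 1))) :
    M ≅ total (toConc t h) :=
  HomologicalComplex.Hom.isoOfComponents
    (fun l => e l ≪≫ biprod.mapIso (signIso (l + 1) (congrArg T (sub_add_cancel l 1).symm)) (Iso.refl (K.X l)))
    (by
      rintro l _ rfl
      have h₁ := ofComponents_sign l (congrArg T (sub_add_cancel l 1).symm)
        (congrArg T (sub_add_cancel (l + 1) 1).symm) (t l) (K.d l (l + 1))
      have h₂ := vertComp_toConc t h l (l + 1 - 1) (by omega)
      change ((e l).hom ≫ biprod.map _ (𝟙 _)) ≫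
          Biprod.ofComponents ((conc T).d _ _) 0 (vertComp (toConc t h) l (l + 1 - 1)) _
        = M.d l (l + 1) ≫ (e (l + 1)).hom ≫ biprod.map _ (𝟙 _)
      rw [h₂, conc_d, reassoc_of% (he l)]
      exact (Category.assoc _ _ _).trans (congrArg ((e l).hom ≫ ·) h₁.symm))

end Concentrated

/-! ### Formal sums with at most one term -/

section Indexed

variable {C : Type*} [Category C] [Preadditive C]

/-- The formal sum with the single term `x` if `p` holds, and without terms otherwise. -/
def ind (p : Prop) [Decidable p] (x : C) : Mat_ C := { ι := PLift p, X := fun _ => x }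

variable {p q r : Prop} [Decidable p] [Decidable q] [Decidable r] {x y z : C}

/-- The matrix with at most one entry `f`. -/
def indMap (f : x ⟶ y) : ind p x ⟶ ind q y := fun _ _ => f

/-- The matrix product sums over the middle index set, so the middle term has to be present whenever
both outer ones are; otherwise the product would be an empty sum. -/
theorem indMap_comp (h : p → r → q) (f : x ⟶ y) (g : y ⟶ z) :
    (indMap f : ind p x ⟶ ind q y) ≫ (indMap g : _ ⟶ ind r z) = indMap (f ≫ g) := by
  ext (a : PLift p) (b : PLift r)
  exact Fintype.sum_subsingleton (fun _ : PLift q => f ≫ g) ⟨h a.down b.down⟩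

theorem ind_isZero (h : ¬ p) : IsZero (ind p x) := by
  rw [IsZero.iff_id_eq_zero]
  ext (a : PLift p) b
  exact (h a.down).elim

theorem indMap_id : (indMap (𝟙 x) : ind p x ⟶ ind p x) = 𝟙 _ := by
  ext (a : PLift p) (b : PLift p)
  obtain rfl : a = b := Subsingleton.elim _ _
  exact (Mat_.id_apply_self (ind p x) a).symm

theorem indMap_zero : (indMap 0 : ind p x ⟶ ind q y) = 0 := rfl

theorem indMap_add (f g : x ⟶ y) :
    (indMap (f + g) : ind p x ⟶ ind q y) = indMap f + indMap g := rfl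

theorem indMap_eq_zero (h : p → ¬ q) (f : x ⟶ y) : (indMap f : ind p x ⟶ ind q y) = 0 := by
  ext (a : PLift p) (b : PLift q)
  exact (h a.down b.down).elim

/-- The terms `X m` for the natural numbers `m` with `P m`. -/
def part (P : ℕ → Prop) [DecidablePred P] (X : ℕ → C) : ℤ → Mat_ C
  | .ofNat m => ind (P m) (X m)
  | .negSucc _ => { ι := Empty, X := fun a => a.elim }

theorem part_isZero {P : ℕ → Prop} [DecidablePred P] {X : ℕ → C} (l : ℤ)
    (h : ∀ m : ℕ, l = m → ¬ P m) : IsZero (part P X l) := by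
  rcases l with m | m
  · exact ind_isZero (h m rfl)
  · rw [IsZero.iff_id_eq_zero]
    ext a b
    exact Empty.elim a

end Indexed

/-! ### Components of the bottom row along its decomposition -/

section Sequences

variable {C : Type*} [Category C] [Preadditive C]

variable {X Y : ℕ → C} (N : ℕ) (d : ∀ m, X m ⟶ X (m + 1)) (hd : ∀ m, d m ≫ d (m + 1) = 0)
  (d' : ∀ m, Y m ⟶ Y (m + 1)) (hd' : ∀ m, d' m ≫ d' (m + 1) = 0)
  (u : ∀ m, Y m ⟶ X m) (v : ∀ m, Y m ⟶ X (m + 1))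

theorem seqComplex_d (l : ℤ) : (seqComplex N X d hd).d l (l + 1) = seqMap N X d l :=
  CochainComplex.of_d (seqObj N X) (seqMap N X d) l

/-- The first components `Y m → X m` of a decomposition of a sequence. -/
def fstComp : ∀ l : ℤ, seqObj N Y l ⟶ part (fun m => 1 ≤ m ∧ m ≤ N) X l
  | .ofNat m => indMap (u m)
  | .negSucc _ => fun a => a.elim

/-- The second components `Y m → X (m + 1)` of a decomposition of a sequence. -/
def sndComp (P : ℕ → Prop) [DecidablePred P] : ∀ l : ℤ, seqObj N Y l ⟶ part P X (l + 1)
  | .ofNat m => (indMap (v m) : ind (m ≤ N) (Y m) ⟶ ind (P (m + 1)) (X (m + 1)))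
  | .negSucc _ => fun a => a.elim

/-- The bound `1 ≤ m` reflects that `Y 0` is `X 1` alone, without a first summand; the bound `m ≤ N`
leaves the second summand of `Y N` unpaired. -/
theorem seqMap_fstComp (h : ∀ m, d' m ≫ u (m + 1) = v m) (l : ℤ) :
    seqMap N Y d' l ≫ fstComp N u (l + 1) = sndComp N v (fun m => 1 ≤ m ∧ m ≤ N) l := by
  rcases l with m | m
  · refine (indMap_comp (p := m ≤ N) (q := m + 1 ≤ N) (r := 1 ≤ m + 1 ∧ m + 1 ≤ N)
      (fun _ h => h.2) (d' m) (u (m + 1))).trans ?_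
    rw [h]
    rfl
  · exact (seqObj_isZero N Y _ (by simp)).eq_of_src _ _

/-- The predicate is left free because the vanishing is needed for the paired terms, `1 ≤ m ∧ m ≤
N`, and for the surviving one, `m = N + 1`. With `v = d` it also shows that the last differential of
the longer top row defines a map to `conc`. -/
theorem seqMap_sndComp (P : ℕ → Prop) [DecidablePred P] (hP : ∀ m, P (m + 1) → m ≤ N)
    (h : ∀ m, d' m ≫ v (m + 1) = 0) (l : ℤ) :
    seqMap N Y d' l ≫ sndComp N v P (l + 1) = 0 := by
  rcases l with m | m
  · refine (indMap_comp (p := m ≤ N) (q := m + 1 ≤ N) (r := P (m + 1 + 1))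
      (fun _ h => hP _ h) (d' m) (v (m + 1))).trans ?_
    rw [h]
    rfl
  · exact (seqObj_isZero N Y _ (by simp)).eq_of_src _ _

/-- The target is nonzero only for `l = N`, so the vertical arrow needs to be known in the last
column alone. -/
theorem seqHomF_sndComp {v : ∀ m, Y m ⟶ X (m + 1)} {f : ∀ m, X m ⟶ Y m} (h : f N ≫ v N = d N)
    (l : ℤ) : seqHomF N f l ≫ sndComp N v (fun m => m = N + 1) l
      = sndComp N d (fun m => m = N + 1) l := by
  rcases l with m | m
  · refine (indMap_comp (p := m ≤ N) (q := m ≤ N) (r := m + 1 = N + 1)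
      (fun h _ => h) (f m) (v m)).trans ?_
    by_cases hm : m = N
    · subst hm
      rw [h]
      rfl
    · exact (indMap_eq_zero (fun _ => by omega) _).trans
        (indMap_eq_zero (p := m ≤ N) (fun _ => by omega) (d m)).symm
  · exact (seqObj_isZero _ X _ (by simp)).eq_of_src _ _

end Sequences

/-! ### Splitting the bottom row and recognizing the extended top row -/

section Reduction

variable {C : Type*} [Category C] [Preadditive C] [HasBinaryBiproducts (Mat_ C)]

/-- Here `p` says that the column exists, `a` that its first summand is present, `b` that its second
summand is paired with the next column, and `c` that it survives. For an existing column exactly one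
of `b`, `c` holds, so the two copies of `v` together amount to one. If `a` fails, `v` alone is
invertible. -/
theorem isIso_decomposition {p a b c : Prop} [Decidable p] [Decidable a] [Decidable b]
    [Decidable c] (ha : a → p) (hb : b → p) (hc : c → p) (hbc : b → ¬ c) (hp : p → b ∨ c)
    {x y z : C} (u : y ⟶ x) (v : y ⟶ z) (u' : x ⟶ y) (v' : z ⟶ y) (h₁ : a → u' ≫ u = 𝟙 x)
    (h₂ : v' ≫ v = 𝟙 z) (h₃ : u' ≫ v = 0) (h₄ : v' ≫ u = 0) (h₅ : a → u ≫ u' + v ≫ v' = 𝟙 y)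
    (h₆ : p → ¬ a → v ≫ v' = 𝟙 y) :
    IsIso (biprod.lift (biprod.lift (indMap u) (indMap v)) (indMap v) :
      ind p y ⟶ (ind a x ⊞ ind b z) ⊞ ind c z) := by
  refine ⟨biprod.desc (biprod.desc (indMap u') (indMap v')) (indMap v'), ?_, ?_⟩
  · rw [biprod.lift_desc, biprod.lift_desc]
    by_cases hp' : p
    swap
    · exact (ind_isZero hp').eq_of_src _ _
    have e₁ : (indMap u : ind p y ⟶ ind a x) ≫ indMap u' + indMap (v ≫ v')
        = 𝟙 (ind p y) := by
      by_cases ha' : a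
      · rw [indMap_comp (fun _ _ => ha'), ← indMap_add, h₅ ha', indMap_id]
      · rw [indMap_eq_zero (fun _ => ha') u, zero_comp, zero_add, h₆ hp' ha', indMap_id]
    rw [← e₁, add_assoc]
    congr 1
    by_cases hb' : b
    · rw [indMap_comp (fun _ _ => hb'), indMap_eq_zero (fun _ => hbc hb') v, zero_comp, add_zero]
    · rw [indMap_comp (q := c) (fun _ _ => (hp hp').resolve_left hb'),
        indMap_eq_zero (fun _ => hb') v, zero_comp, zero_add]
  · have ea : (indMap u' : ind a x ⟶ ind p y) ≫ indMap u = 𝟙 (ind a x) := by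
      by_cases ha' : a
      · rw [indMap_comp fun _ => ha, h₁ ha', indMap_id]
      · exact (ind_isZero ha').eq_of_src _ _
    have eb : (indMap v' : ind b z ⟶ ind p y) ≫ indMap v = 𝟙 (ind b z) := by
      rw [indMap_comp fun _ => hb, h₂, indMap_id]
    have ec : (indMap v' : ind c z ⟶ ind p y) ≫ indMap v = 𝟙 (ind c z) := by
      rw [indMap_comp fun _ => hc, h₂, indMap_id]
    have eab : (indMap u' : ind a x ⟶ ind p y) ≫ (indMap v : _ ⟶ ind b z) = 0 := by
      rw [indMap_comp fun _ => hb, h₃, indMap_zero]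
    have eac : (indMap u' : ind a x ⟶ ind p y) ≫ (indMap v : _ ⟶ ind c z) = 0 := by
      rw [indMap_comp fun _ => hc, h₃, indMap_zero]
    have eba : (indMap v' : ind b z ⟶ ind p y) ≫ (indMap u : _ ⟶ ind a x) = 0 := by
      rw [indMap_comp fun _ => ha, h₄, indMap_zero]
    have eca : (indMap v' : ind c z ⟶ ind p y) ≫ (indMap u : _ ⟶ ind a x) = 0 := by
      rw [indMap_comp fun _ => ha, h₄, indMap_zero]
    have ebc : (indMap v' : ind b z ⟶ ind p y) ≫ (indMap v : _ ⟶ ind c z) = 0 := by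
      rw [indMap_comp fun _ => hc, indMap_eq_zero hbc]
    have ecb : (indMap v' : ind c z ⟶ ind p y) ≫ (indMap v : _ ⟶ ind b z) = 0 := by
      rw [indMap_comp fun _ => hb, indMap_eq_zero fun h h' => hbc h' h]
    apply biprod.hom_ext'
    · apply biprod.hom_ext'
      · apply biprod.hom_ext
        · apply biprod.hom_ext <;> simp [ea, eab]
        · simp [eac]
      · apply biprod.hom_ext
        · apply biprod.hom_ext <;> simp [eb, eba]
        · simp [ebc]
    · apply biprod.hom_ext
      · apply biprod.hom_ext <;> simp [eca, ecb]
      · simp [ec]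

/-- A one-term sum splits according to two exclusive cases. -/
noncomputable def indIso {p a b : Prop} [Decidable p] [Decidable a] [Decidable b] (ha : a → p)
    (hb : b → p) (hab : a → ¬ b) (hp : p → a ∨ b) (x : C) : ind p x ≅ ind a x ⊞ ind b x where
  hom := biprod.lift (indMap (𝟙 x)) (indMap (𝟙 x))
  inv := biprod.desc (indMap (𝟙 x)) (indMap (𝟙 x))
  hom_inv_id := by
    rw [biprod.lift_desc]
    by_cases hp' : p
    swap
    · exact (ind_isZero hp').eq_of_src _ _
    by_cases ha' : a
    · rw [indMap_comp (fun _ _ => ha'), indMap_eq_zero (fun _ => hab ha'), zero_comp, add_zero,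
        Category.comp_id, indMap_id]
    · rw [indMap_comp (q := b) (fun _ _ => (hp hp').resolve_left ha'),
        indMap_eq_zero (fun _ => ha'), zero_comp, zero_add, Category.comp_id, indMap_id]
  inv_hom_id := by
    apply biprod.hom_ext'
    · apply biprod.hom_ext
      · simp [indMap_comp fun _ => ha, indMap_id]
      · simp [indMap_comp fun _ => hb, indMap_eq_zero hab]
    · apply biprod.hom_ext
      · simp [indMap_comp fun _ => ha, indMap_eq_zero fun h h' => hab h' h]
      · simp [indMap_comp fun _ => hb, indMap_id]

variable {X Y : ℕ → C} (N : ℕ) (d : ∀ m, X m ⟶ X (m + 1)) (hd : ∀ m, d m ≫ d (m + 1) = 0)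
  (d' : ∀ m, Y m ⟶ Y (m + 1)) (hd' : ∀ m, d' m ≫ d' (m + 1) = 0)
  (u : ∀ m, Y m ⟶ X m) (v : ∀ m, Y m ⟶ X (m + 1))

/-- The decomposition of the complex `Y 0 → Y 1 → ⋯ → Y N` into `pairs` and a term in
degree `N`. -/
noncomputable def seqComplexIso (h : ∀ m, d' m ≫ u (m + 1) = v m)
    (h' : ∀ m, d' m ≫ v (m + 1) = 0) (u' : ∀ m, X m ⟶ Y m) (v' : ∀ m, X (m + 1) ⟶ Y m)
    (h₁ : ∀ m, 1 ≤ m → u' m ≫ u m = 𝟙 _) (h₂ : ∀ m, v' m ≫ v m = 𝟙 _)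
    (h₃ : ∀ m, u' m ≫ v m = 0) (h₄ : ∀ m, v' m ≫ u m = 0)
    (h₅ : ∀ m, 1 ≤ m → u m ≫ u' m + v m ≫ v' m = 𝟙 _) (h₆ : v 0 ≫ v' 0 = 𝟙 _) :
    seqComplex N Y d' hd' ≅
      pairs (part (fun m => 1 ≤ m ∧ m ≤ N) X) ⊞ conc (part (fun m => m = N + 1) X) :=
  isoBiprodOfLift
    (toPairs (L := seqComplex N Y d' hd') (fstComp N u) (sndComp N v _)
      (fun l => by rw [seqComplex_d]; exact seqMap_fstComp N d' u v h l)
      (fun l => by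
        rw [seqComplex_d]; exact seqMap_sndComp N d' v _ (fun m h => by omega) h' l))
    (toConc (K := seqComplex N Y d' hd') (sndComp N v fun m => m = N + 1)
      (fun l => by
        rw [seqComplex_d]; exact seqMap_sndComp N d' v _ (fun m h => by omega) h' l))
    (by
      rintro (m | m)
      · exact isIso_decomposition (p := m ≤ N) (a := 1 ≤ m ∧ m ≤ N) (b := 1 ≤ m + 1 ∧ m + 1 ≤ N)
          (c := m + 1 = N + 1) (by omega) (by omega) (by omega) (by omega) (by omega) (u m) (v m)
          (u' m) (v' m) (fun h => h₁ m h.1) (h₂ m) (h₃ m) (h₄ m) (fun h => h₅ m h.1)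
          -- Column `0` is the only existing column without a first summand.
          (fun hm hm' => by obtain rfl : m = 0 := by omega
                            exact h₆)
      -- In negative degrees both sides vanish. Degree `-1` of `pairs` and of `conc` involves the
      -- index `0`, hence `l ≤ 0` rather than `l < 0`.
      · have hA : ∀ l : ℤ, l ≤ 0 → IsZero (part (fun m => 1 ≤ m ∧ m ≤ N) X l) :=
          fun l hl => part_isZero l (by omega)
        have h0 := seqObj_isZero N Y (Int.negSucc m) (by simp)
        have h1 := pairs_isZero (hA (Int.negSucc m) (by omega)) (hA (Int.negSucc m + 1) (by omega))
        have h2 : IsZero (part (fun m => m = N + 1) X (Int.negSucc m + 1)) :=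
          part_isZero _ (by omega)
        refine ⟨0, h0.eq_of_src _ _, biprod.hom_ext' _ _ ?_ ?_⟩
        · exact h1.eq_of_src _ _
        · exact IsZero.eq_of_src h2 _ _)

/-- Hypothesis `h` says that an entry of the differential can only start at an old term `b`; the new
last term `a` has nothing leaving it, whence the zero entries of the matrix. -/
theorem indMap_indIso {p a b p' a' b' : Prop} [Decidable p] [Decidable a] [Decidable b]
    [Decidable p'] [Decidable a'] [Decidable b'] (ha : a → p) (hb : b → p) (hab : a → ¬ b)
    (hp : p → a ∨ b) (ha' : a' → p') (hb' : b' → p') (hab' : a' → ¬ b') (hp' : p' → a' ∨ b')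
    (h : p → p' → b) {x y : C} (f : x ⟶ y) :
    indMap f ≫ (indIso ha' hb' hab' hp' y).hom
      = (indIso ha hb hab hp x).hom ≫ Biprod.ofComponents 0 0 (indMap f) (indMap f) := by
  have h₁ : (indMap f : ind p x ⟶ ind p' y) ≫ (indMap (𝟙 y) : _ ⟶ ind a' y)
      = (indMap (𝟙 x) : _ ⟶ ind b x) ≫ indMap f := by
    rw [indMap_comp fun _ => ha', indMap_comp fun hp ha => h hp (ha' ha), Category.comp_id,
      Category.id_comp]
  have h₂ : (indMap f : ind p x ⟶ ind p' y) ≫ (indMap (𝟙 y) : _ ⟶ ind b' y)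
      = (indMap (𝟙 x) : _ ⟶ ind b x) ≫ indMap f := by
    rw [indMap_comp fun _ => hb', indMap_comp fun hp hb => h hp (hb' hb), Category.comp_id,
      Category.id_comp]
  apply biprod.hom_ext <;> simp [indIso, Biprod.ofComponents, h₁, h₂]

/-- The terms of `X 0 → ⋯ → X (N + 1)` are those of `X 0 → ⋯ → X N` and `X (N + 1)`. -/
noncomputable def seqObjSuccIso : ∀ l : ℤ,
    seqObj (N + 1) X l ≅ part (fun m => m = N + 1) X l ⊞ seqObj N X l
  | .ofNat m => indIso (p := m ≤ N + 1) (a := m = N + 1) (b := m ≤ N) (by omega) (by omega)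
      (by omega) (by omega) (X m)
  | .negSucc m => IsZero.iso (seqObj_isZero _ _ _ (by simp)) (by
      rw [IsZero.iff_id_eq_zero]
      exact biprod.hom_ext' _ _ ((part_isZero _ (by simp)).eq_of_src _ _)
        ((seqObj_isZero _ _ _ (by simp)).eq_of_src _ _))

theorem seqMap_seqObjSuccIso (l : ℤ) :
    seqMap (N + 1) X d l ≫ (seqObjSuccIso N (l + 1)).hom = (seqObjSuccIso N l).hom ≫
      Biprod.ofComponents 0 0 (sndComp N d (fun m => m = N + 1) l) (seqMap N X d l) := by
  rcases l with m | m
  · exact indMap_indIso (p := m ≤ N + 1) (a := m = N + 1) (b := m ≤ N) (p' := m + 1 ≤ N + 1)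
      (a' := m + 1 = N + 1) (b' := m + 1 ≤ N) (by omega) (by omega) (by omega) (by omega)
      (by omega) (by omega) (by omega) (by omega) (by omega) (d m)
  · exact (seqObj_isZero _ X _ (by simp)).eq_of_src _ _

/-- The complex `X 0 → X 1 → ⋯ → X (N + 1)` as a total complex. -/
noncomputable def seqComplexSuccIso :
    seqComplex (N + 1) X d hd ≅ total (toConc (K := seqComplex N X d hd)
      (T := part (fun m => m = N + 1) X) (sndComp N d _)
      (fun l => by
        rw [seqComplex_d]; exact seqMap_sndComp N d d _ (fun m h => by omega) hd l)) :=
  totalConcIso (M := seqComplex (N + 1) X d hd) _ _ (seqObjSuccIso N) (fun l => by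
    rw [seqComplex_d, seqComplex_d]
    exact seqMap_seqObjSuccIso N d l)

end Reduction

/-! ### The formal reduction theorem -/

section Equivalence

variable {n : ℕ} {E : Set Extra} {i j : Word} {X Y : ℕ → ShGraph n E i j} (N : ℕ)
  {d : ∀ m, X m ⟶ X (m + 1)} (hd : ∀ m, d m ≫ d (m + 1) = 0)
  {d' : ∀ m, Y m ⟶ Y (m + 1)} (hd' : ∀ m, d' m ≫ d' (m + 1) = 0)
  {u : ∀ m, Y m ⟶ X m} {v : ∀ m, Y m ⟶ X (m + 1)}

/-- If the bottom row of a two-row bicomplex cancels up to its last term, then the total complex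
is equivalent to the top row extended by that term. -/
theorem equivalent_total_seqHom (h : ∀ m, d' m ≫ u (m + 1) = v m)
    (h' : ∀ m, d' m ≫ v (m + 1) = 0) (u' : ∀ m, X m ⟶ Y m) (v' : ∀ m, X (m + 1) ⟶ Y m)
    (h₁ : ∀ m, 1 ≤ m → u' m ≫ u m = 𝟙 _) (h₂ : ∀ m, v' m ≫ v m = 𝟙 _)
    (h₃ : ∀ m, u' m ≫ v m = 0) (h₄ : ∀ m, v' m ≫ u m = 0)
    (h₅ : ∀ m, 1 ≤ m → u m ≫ u' m + v m ≫ v' m = 𝟙 _) (h₆ : v 0 ≫ v' 0 = 𝟙 _)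
    (f : ∀ m, X m ⟶ Y m) (hf : ∀ m, d m ≫ f (m + 1) = f m ≫ d' m) (hN : f N ≫ v N = d N)
    (hb hb') :
    Equivalent (n := n) ⟨total (seqHom N hd hd' f hf), hb⟩ ⟨seqComplex (N + 1) X d hd, hb'⟩ := by
  let e := seqComplexIso N d' hd' u v h h' u' v' h₁ h₂ h₃ h₄ h₅ h₆
  let F := seqHom N hd hd' f hf
  -- Once the contractible part is discarded, the vertical map is `d N : X N → X (N + 1)` in column
  -- `N` and zero elsewhere.
  have hF : (F ≫ e.hom) ≫ biprod.snd = toConc (K := seqComplex N X d hd)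
      (T := part (fun m => m = N + 1) X) (sndComp N d _) (fun l => by
        rw [seqComplex_d]; exact seqMap_sndComp N d d _ (fun m h => by omega) hd l) := by
    have he : e.hom ≫ biprod.snd
        = toConc (K := seqComplex N Y d' hd') (sndComp N v fun m => m = N + 1) _ :=
      biprod.lift_snd _ _
    rw [Category.assoc, he]
    exact HomologicalComplex.hom_ext _ _ fun l => seqHomF_sndComp N d hN l
  obtain ⟨a, b, hab⟩ := hb
  obtain ⟨a', b', hab'⟩ := hb'
  have b₁ : ∀ m, m < a ∨ b < m → IsZero ((total (F ≫ e.hom)).X m) := fun m hm =>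
    (hab m hm).of_iso ((HomologicalComplex.eval _ _ m).mapIso (totalIso F e)).symm
  have b₂ : ∀ m, m < a' ∨ b' < m → IsZero ((total ((F ≫ e.hom) ≫ biprod.snd)).X m) := by
    rw [hF]
    exact fun m hm => (hab' m hm).of_iso
      ((HomologicalComplex.eval _ _ m).mapIso (seqComplexSuccIso N d hd)).symm
  have e₁ : Equivalent (n := n) ⟨total F, a, b, hab⟩ ⟨total (F ≫ e.hom), a, b, b₁⟩ :=
    .rel _ _ (.eq1 ⟨totalIso F e⟩)
  -- The paired objects are `X 1, …, X N`: an interval of length `N` starting at `1`.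
  have e₂ := equivalent_of_pairs 1 N _ (fun m hm => part_isZero m (by omega)) (F ≫ e.hom)
    ⟨a, b, b₁⟩ ⟨a', b', b₂⟩
  have e₃ : Equivalent (n := n) ⟨total ((F ≫ e.hom) ≫ biprod.snd), a', b', b₂⟩
      ⟨seqComplex (N + 1) X d hd, a', b', hab'⟩ :=
    .rel _ _ (.eq1 ⟨eqToIso (by rw [hF]) ≪≫ (seqComplexSuccIso N d hd).symm⟩)
  exact e₁.trans _ _ _ (e₂.trans _ _ _ e₃)

end Equivalence

/-! ### The relations for `φ`, `ψ`, `χ₀`, `α`, `γ` in the two-strand bicomplex -/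

section Braid

variable {n : ℕ} {E : Set Extra}

variable (n) in
/-- The alternating arrows `φ, ψ, φ, ψ, …`, component `S ∘ S → S{-1}`. -/
def altFst : ℕ → Arr n SS S₀ (-1)
  | 0 => .proj .phi (0 : Fin 2)
  | 1 => .proj .psi (0 : Fin 2)
  | m + 2 => altFst m

variable (n) in
/-- The alternating arrows `φ, ψ, φ, ψ, …`, component `S ∘ S → S{1}`. -/
def altSnd : ℕ → Arr n SS S₀ 1
  | 0 => .proj .phi (1 : Fin 2)
  | 1 => .proj .psi (1 : Fin 2)
  | m + 2 => altSnd m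

variable (n) in
/-- The inverses of the alternating arrows, component `S{-1} → S ∘ S`. -/
def altInl : ℕ → Arr n S₀ SS 1
  | 0 => .incl .phi (0 : Fin 2)
  | 1 => .incl .psi (0 : Fin 2)
  | m + 2 => altInl m

variable (n) in
/-- The inverses of the alternating arrows, component `S{1} → S ∘ S`. -/
def altInr : ℕ → Arr n S₀ SS (-1)
  | 0 => .incl .phi (1 : Fin 2)
  | 1 => .incl .psi (1 : Fin 2)
  | m + 2 => altInr m

theorem altInl_altFst : ∀ m,
    GHom.mk E (.comp (altInl n m) (altFst n m) (add_neg_cancel 1)) = GHom.mk E (one S₀)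
  | 0 => Quot.sound (.incl_proj .phi (0 : Fin 2))
  | 1 => Quot.sound (.incl_proj .psi (0 : Fin 2))
  | m + 2 => altInl_altFst m

theorem altInr_altSnd : ∀ m,
    GHom.mk E (.comp (altInr n m) (altSnd n m) (neg_add_cancel 1)) = GHom.mk E (one S₀)
  | 0 => Quot.sound (.incl_proj .phi (1 : Fin 2))
  | 1 => Quot.sound (.incl_proj .psi (1 : Fin 2))
  | m + 2 => altInr_altSnd m

theorem altInl_altSnd : ∀ m,
    GHom.mk E (.comp (altInl n m) (altSnd n m) one_add_one_eq_two) = GHom.mk E .zero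
  | 0 => Quot.sound (.incl_proj_ne .phi (0 : Fin 2) (1 : Fin 2) (zero_ne_one (α := Fin 2)))
  | 1 => Quot.sound (.incl_proj_ne .psi (0 : Fin 2) (1 : Fin 2) (zero_ne_one (α := Fin 2)))
  | m + 2 => altInl_altSnd m

theorem altInr_altFst : ∀ m,
    GHom.mk E (.comp (altInr n m) (altFst n m) (rfl : (-1 : ℤ) + -1 = -2)) = GHom.mk E .zero
  | 0 => Quot.sound (.incl_proj_ne .phi (1 : Fin 2) (0 : Fin 2) (one_ne_zero (α := Fin 2)))
  | 1 => Quot.sound (.incl_proj_ne .psi (1 : Fin 2) (0 : Fin 2) (one_ne_zero (α := Fin 2)))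
  | m + 2 => altInr_altFst m

theorem altFst_altInl_add : ∀ m,
    GHom.mk E (.comp (altFst n m) (altInl n m) (neg_add_cancel 1))
      + GHom.mk E (.comp (altSnd n m) (altInr n m) (add_neg_cancel 1)) = GHom.mk E (one SS)
  | 0 => by
    -- `Arr.sum` is a right fold ending in `zero`, which accounts for the trailing zero summand.
    refine Eq.trans ?_ (Quot.sound (.sum_proj_incl .phi))
    exact congrArg (_ + ·) (add_zero (GHom.mk E _)).symm
  | 1 => by
    refine Eq.trans ?_ (Quot.sound (.sum_proj_incl .psi))
    exact congrArg (_ + ·) (add_zero (GHom.mk E _)).symm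
  | m + 2 => altFst_altInl_add m

/-- The reason for alternating: `1 ∘ α` leads from `φ`-coordinates to `ψ`-coordinates and `1 ∘ γ`
back, each with matrix `(0 1; 0 0)`. This is its first row; `whiskerTop_altArr_altSnd` is the
second. -/
theorem whiskerTop_altArr_altFst : ∀ m,
    GHom.mk E (.comp (whiskerTop S₀ (altArr n m)) (altFst n (m + 1)) (rfl : (2 : ℤ) + -1 = 1))
      = GHom.mk E (altSnd n m)
  | 0 => Quot.sound (.shift1_fst _)
  | 1 => Quot.sound (.shift2_fst _)
  | m + 2 => whiskerTop_altArr_altFst m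

theorem whiskerTop_altArr_altSnd : ∀ m,
    GHom.mk E (.comp (whiskerTop S₀ (altArr n m)) (altSnd n (m + 1)) (rfl : (2 : ℤ) + 1 = 3))
      = GHom.mk E .zero
  | 0 => Quot.sound (.shift1_snd _)
  | 1 => Quot.sound (.shift2_snd _)
  | m + 2 => whiskerTop_altArr_altSnd m

/-- In a column split by `φ` the vertical arrow has second component `α`, in one split by `ψ` it is
`γ`: each time the arrow by which the top row continues. -/
theorem chiTop_altSnd : ∀ m,
    GHom.mk E (.comp chiTop (altSnd n m) one_add_one_eq_two) = GHom.mk E (altArr n m)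
  | 0 => Quot.sound .moy2b_snd
  | 1 => Quot.sound .moy2c_snd
  | m + 2 => chiTop_altSnd m

variable (n E) in
/-- The first component of the decomposition of the bottom row. -/
def fstMap : (m : ℕ) → (botObj n E m ⟶ rowObj n E m)
  | 0 => 0
  | m + 1 => ofArr (botObj n E (m + 1)) (rowObj n E (m + 1)) (altFst n m)
      (by simp [rowObj, botObj])

variable (n E) in
/-- The second component of the decomposition of the bottom row. -/
def sndMap : (m : ℕ) → (botObj n E m ⟶ rowObj n E (m + 1))
  | 0 => ofArr (botObj n E 0) (rowObj n E 1) (one S₀) (by simp [rowObj, botObj])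
  | m + 1 => ofArr (botObj n E (m + 1)) (rowObj n E (m + 2)) (altSnd n m)
      (by simp [rowObj, botObj]; ring)

variable (n E) in
/-- The inclusion of the first summand of the bottom row. -/
def inlMap : (m : ℕ) → (rowObj n E m ⟶ botObj n E m)
  | 0 => 0
  | m + 1 => ofArr (rowObj n E (m + 1)) (botObj n E (m + 1)) (altInl n m)
      (by simp [rowObj, botObj])

variable (n E) in
/-- The inclusion of the second summand of the bottom row. -/
def inrMap : (m : ℕ) → (rowObj n E (m + 1) ⟶ botObj n E m)
  | 0 => ofArr (rowObj n E 1) (botObj n E 0) (one S₀) (by simp [rowObj, botObj])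
  | m + 1 => ofArr (rowObj n E (m + 2)) (botObj n E (m + 1)) (altInr n m)
      (by simp [rowObj, botObj]; ring)

theorem ofArr_one {i j : Word} (X : ShGraph n E i j) (h : 0 = X.shift - X.shift) :
    ofArr X X (one X.graph) h = 𝟙 X := rfl

/-- The step from column `0` to column `1` is the relation for `φ (1 ∘ χ₀)`; every later step is one
of the two shift relations. The same holds for `botMap_sndMap`. -/
theorem botMap_fstMap : ∀ m, botMap n E m ≫ fstMap n E (m + 1) = sndMap n E m
  | 0 => (ofArr_comp _ _ _ _ (add_neg_cancel 1)).trans (ofArr_eq .moy2a_fst _)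
  | m + 1 => (ofArr_comp _ _ _ _ (rfl : (2 : ℤ) + -1 = 1)).trans
      (ofArr_congr (whiskerTop_altArr_altFst m) _)

theorem botMap_sndMap : ∀ m, botMap n E m ≫ sndMap n E (m + 1) = 0
  | 0 => (ofArr_comp _ _ _ _ one_add_one_eq_two).trans
      ((ofArr_eq .moy2a_snd _).trans (ofArr_zero _))
  | m + 1 => (ofArr_comp _ _ _ _ (rfl : (2 : ℤ) + 1 = 3)).trans
      ((ofArr_congr (whiskerTop_altArr_altSnd m) _).trans (ofArr_zero _))

theorem inlMap_fstMap (m : ℕ) (hm : 1 ≤ m) : inlMap n E m ≫ fstMap n E m = 𝟙 _ := by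
  obtain ⟨m, rfl⟩ := Nat.exists_eq_add_of_le' hm
  exact (ofArr_comp _ _ _ _ (add_neg_cancel 1)).trans
    ((ofArr_congr (altInl_altFst m) _).trans (ofArr_one _ (sub_self _).symm))

theorem inrMap_sndMap : ∀ m, inrMap n E m ≫ sndMap n E m = 𝟙 _
  | 0 => (ofArr_comp _ _ _ _ (add_zero 0)).trans
      ((ofArr_eq (.one_comp _) _).trans (ofArr_one _ (sub_self _).symm))
  | m + 1 => (ofArr_comp _ _ _ _ (neg_add_cancel 1)).trans
      ((ofArr_congr (altInr_altSnd m) _).trans (ofArr_one _ (sub_self _).symm))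

theorem sndMap_zero_inrMap_zero : sndMap n E 0 ≫ inrMap n E 0 = 𝟙 _ :=
  (ofArr_comp _ _ _ _ (add_zero 0)).trans
    ((ofArr_eq (.one_comp _) _).trans (ofArr_one _ (sub_self _).symm))

theorem inlMap_sndMap : ∀ m, inlMap n E m ≫ sndMap n E m = 0
  | 0 => zero_comp
  | m + 1 => (ofArr_comp _ _ _ _ one_add_one_eq_two).trans
      ((ofArr_congr (altInl_altSnd m) _).trans (ofArr_zero _))

theorem inrMap_fstMap : ∀ m, inrMap n E m ≫ fstMap n E m = 0
  | 0 => comp_zero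
  | m + 1 => (ofArr_comp _ _ _ _ (rfl : (-1 : ℤ) + -1 = -2)).trans
      ((ofArr_congr (altInr_altFst m) _).trans (ofArr_zero _))

theorem ofArr_add_eq_id {i j : Word} {X : ShGraph n E i j} {f g : Arr n X.graph X.graph 0}
    (r : GHom.mk E f + GHom.mk E g = GHom.mk E (one X.graph)) (h h') :
    ofArr X X f h + ofArr X X g h' = 𝟙 X := by
  -- The degree `X.shift - X.shift` is not literally `0`, so it is generalized to `k` to eliminate
  -- the casts.
  have key : ∀ (k : ℤ) (hk : 0 = k), GHom.cast hk (GHom.mk E f) + GHom.cast hk (GHom.mk E g)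
      = GHom.cast hk (GHom.mk E (one X.graph)) := by
    rintro _ rfl
    exact r
  exact key _ h

theorem fstMap_inlMap_add (m : ℕ) (hm : 1 ≤ m) :
    fstMap n E m ≫ inlMap n E m + sndMap n E m ≫ inrMap n E m = 𝟙 _ := by
  obtain ⟨m, rfl⟩ := Nat.exists_eq_add_of_le' hm
  exact (congrArg₂ (· + ·) (ofArr_comp _ _ _ _ (neg_add_cancel 1))
    (ofArr_comp _ _ _ _ (add_neg_cancel 1))).trans
    (ofArr_add_eq_id (X := botObj n E (m + 1)) (altFst_altInl_add m) _ _)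

/-- Identifies the arrow into the surviving term with the next top differential. In column `0` the
source is `id₂` and the bottom term is not split, so the argument through `φ` and `ψ` starts at `m =
1`. -/
theorem vertMap_sndMap (m : ℕ) (hm : 1 ≤ m) : vertMap n E m ≫ sndMap n E m = rowMap n E m := by
  obtain ⟨m, rfl⟩ := Nat.exists_eq_add_of_le' hm
  exact (ofArr_comp _ _ _ _ one_add_one_eq_two).trans (ofArr_congr (chiTop_altSnd m) _)

variable (n E) in
/-- The total complex with `N + 1 ≥ 2` columns is equivalent to the row with `N + 2` terms. -/
theorem equivalent_totalComplex_rowComplex (N : ℕ) (hN : 1 ≤ N) :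
    Equivalent (totalComplex n E N) (rowComplex n E (N + 1)) :=
  equivalent_total_seqHom N rowMap_rowMap botMap_botMap botMap_fstMap botMap_sndMap
    (inlMap n E) (inrMap n E) inlMap_fstMap inrMap_sndMap inlMap_sndMap inrMap_fstMap
    fstMap_inlMap_add sndMap_zero_inrMap_zero (vertMap n E) rowMap_vertMap (vertMap_sndMap N hN)
    (totalComplex n E N).bounded (rowComplex n E (N + 1)).bounded

end Braid

end MOY

/-- Both parts are instances of one statement about a last column `N ≥ 1`. The parity of `N` only
decides whether the appended arrow is `γ` (`N = 2k`) or `α` (`N = 2k + 1`). -/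
theorem mainTheorem4 (n : ℕ) (hn : 2 ≤ n) (E : Set MOY.Extra) :
    (∀ k : ℕ, 1 ≤ k →
      MOY.Equivalent (MOY.totalComplex n E (2 * k)) (MOY.rowComplex n E (2 * k + 1))) ∧
    (∀ k : ℕ,
      MOY.Equivalent (MOY.totalComplex n E (2 * k + 1)) (MOY.rowComplex n E (2 * k + 2))) :=
  ⟨fun k hk => MOY.equivalent_totalComplex_rowComplex n E (2 * k) (by omega),
    fun k => MOY.equivalent_totalComplex_rowComplex n E (2 * k + 1) (by omega)⟩
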